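/- Let $\zeta$ be a primitive $7$-th root of unity and $\omega$ a primitive cube root of unity in $\mathbb{C}$, and let $\Phi_4=x^3y+y^3z+z^3x$ be Klein's quartic. Let $G\subset \mathrm{SL}_3(\mathbb{C})$ be the Klein group (of order $168$), generated by $$\begin{pmatrix}\zeta^4&0&0\\0&\zeta^2&0\\0&0&\zeta\end{pmatrix},\quad \begin{pmatrix}0&1&0\\0&0&1\\1&0&0\end{pmatrix},\quad \frac{2\zeta^4+2\zeta^2+2\zeta+1}{7}\begin{pmatrix}\zeta-\zeta^6&\zeta^2-\zeta^5&\zeta^4-\zeta^3\\ \zeta^2-\zeta^5&\zeta^4-\zeta^3&\zeta-\zeta^6\\ \zeta^4-\zeta^3&\zeta-\zeta^6&\zeta^2-\zeta^5\end{pmatrix},$$ acting on $\mathbb{P}^2=\mathbb{P}^2_{\mathbb{C}}$. Let $\mathbf{O}_{28}$ be the $G$-orbit of $[1:1:1]$ and $\mathbf{O}_{56}$ the $G$-orbit of $[\omega^2:\omega:1]$. Let $\nabla(\Phi_4):\mathbb{P}^2\to\mathbb{P}^2$ be the gradient map $$[x:y:z]\mapsto[3x^2y+z^3:3y^2z+x^3:3z^2x+y^3],$$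 where the dual plane is identified with $\mathbb{P}^2$ through coordinates. Let $\Phi_6=-\frac1{54}H(\Phi_4)$, where $H$ is the Hessian determinant; let $$\Phi_{14}=\frac19\det\begin{pmatrix}\mathrm{Hess}(\Phi_4)&\nabla\Phi_6^{T}\\ \nabla\Phi_6&0\end{pmatrix};$$ let $\Phi_{21}=\frac1{14}J(\Phi_4,\Phi_6,\Phi_{14})$, where $J$ is the Jacobian determinant; and let $\mathcal{K}=V(\Phi_{63})$, where $\Phi_{63}=\Phi_{21}(\partial_x\Phi_4,\partial_y\Phi_4,\partial_z\Phi_4)$. ($\Phi_{21}=0$ is Klein's arrangement of $21$ lines, and $\mathcal{K}$ is the arrangement of the $21$ reducible polars of $\Phi_4$, consisting of $21$ lines and $21$ conics.) Then the orbits $\mathbf{O}_{28}$ and $\mathbf{O}_{56}$ have $28$ and $56$ points respectively, and: 1. Each point of $\mathbf{O}_{28}$ has exactly $9$ distinct preimages under $\nabla(\Phi_4)$. 2. The whole preimage $\nabla(\Phi_4)^{-1}(\mathbf{O}_{28})$ is the union of $\mathbf{O}_{28}$, $\mathbf{O}_{56}$ and two distinct $G$-orbits of size $84$. 3. Every point of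 $\nabla(\Phi_4)^{-1}(\mathbf{O}_{28})$ is an ordinary triple point of $\mathcal{K}$, i.e. a point of multiplicity $3$ with three distinct tangent lines. -/

import Mathlib

open MvPolynomial
open scoped LinearAlgebra.Projectivization

namespace Klein

noncomputable section

/-- The ring `ℂ[x, y, z]`, with `x = X 0`, `y = X 1`, `z = X 2`. -/
abbrev S : Type := MvPolynomial (Fin 3) ℂ

/-- The complex projective plane. The dual plane is identified with it through coordinates. -/
abbrev P2 : Type := ℙ ℂ (Fin 3 → ℂ)

/-! ### The invariant forms -/

/-- Klein's quartic `x³y + y³z + z³x`. -/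
def Phi4 : S := X 0 ^ 3 * X 1 + X 1 ^ 3 * X 2 + X 2 ^ 3 * X 0

/-- The Hessian matrix of a form. -/
def hessian (F : S) : Matrix (Fin 3) (Fin 3) S :=
  Matrix.of fun i j => pderiv i (pderiv j F)

/-- The sextic invariant, a multiple of the Hessian determinant of `Phi4`. -/
def Phi6 : S := C (-1 / 54) * (hessian Phi4).det

/-- The bordered Hessian determinant of `F` and `H`. -/
def borderedHessian (F H : S) : S :=
  (Matrix.fromBlocks (hessian F) (Matrix.of fun i (_ : Fin 1) => pderiv i H)
    (Matrix.of fun (_ : Fin 1) j => pderiv j H) 0).det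

/-- The invariant of degree 14. -/
def Phi14 : S := C (1 / 9) * borderedHessian Phi4 Phi6

/-- The Jacobian determinant of three forms. -/
def jacobian (F : Fin 3 → S) : S := (Matrix.of fun i j => pderiv j (F i)).det

/-- The invariant of degree 21, the equation of Klein's arrangement of 21 lines. -/
def Phi21 : S := C (1 / 14) * jacobian ![Phi4, Phi6, Phi14]

/-- The pullback of `Phi21` under the gradient map of `Phi4`: the equation of the arrangement
`𝒦` of the 21 reducible polars (21 lines and 21 conics). -/
def Phi63 : S := bind₁ (fun i => pderiv i Phi4) Phi21

/-! ### The gradient map -/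

/-- The vector of partial derivatives of `Phi4` at a vector of `ℂ³`. -/
def gradVec (v : Fin 3 → ℂ) : Fin 3 → ℂ := fun i => eval v (pderiv i Phi4)

lemma gradVec_eq (v : Fin 3 → ℂ) :
    gradVec v = ![3 * v 0 ^ 2 * v 1 + v 2 ^ 3, 3 * v 1 ^ 2 * v 2 + v 0 ^ 3,
      3 * v 2 ^ 2 * v 0 + v 1 ^ 3] := by
  funext i
  fin_cases i <;> simp [gradVec, Phi4, pderiv_X] <;> ring

lemma gradVec_smul (c : ℂ) (v : Fin 3 → ℂ) : gradVec (c • v) = c ^ 3 • gradVec v := by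
  funext i
  fin_cases i <;> simp [gradVec_eq] <;> ring

lemma gradVec_ne_zero {v : Fin 3 → ℂ} (hv : v ≠ 0) : gradVec v ≠ 0 := by
  intro h
  apply hv
  rw [gradVec_eq] at h
  have h0 : 3 * v 0 ^ 2 * v 1 + v 2 ^ 3 = 0 := congrFun h 0
  have h1 : 3 * v 1 ^ 2 * v 2 + v 0 ^ 3 = 0 := congrFun h 1
  have h2 : 3 * v 2 ^ 2 * v 0 + v 1 ^ 3 = 0 := congrFun h 2
  have hx : v 0 ^ 3 = -(3 * v 1 ^ 2 * v 2) := by linear_combination h1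
  have hy : v 1 ^ 3 = -(3 * v 2 ^ 2 * v 0) := by linear_combination h2
  have hz : v 2 ^ 3 = -(3 * v 0 ^ 2 * v 1) := by linear_combination h0
  have hp : (v 0 * v 1 * v 2) ^ 3 = 0 := by
    have : (v 0 * v 1 * v 2) ^ 3 = -27 * (v 0 * v 1 * v 2) ^ 3 := by
      calc (v 0 * v 1 * v 2) ^ 3 = v 0 ^ 3 * v 1 ^ 3 * v 2 ^ 3 := by ring
        _ = _ := by rw [hx, hy, hz]; ring
    linear_combination this / 28
  have key : v 0 = 0 ∧ v 1 = 0 ∧ v 2 = 0 := by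
    rcases mul_eq_zero.1 ((pow_eq_zero_iff (by norm_num)).1 hp) with h' | h'
    · rcases mul_eq_zero.1 h' with h' | h'
      · simp [h'] at hz hy
        exact ⟨h', hy, hz⟩
      · simp [h'] at hx hz
        exact ⟨hx, h', hz⟩
    · simp [h'] at hx hy
      exact ⟨hx, hy, h'⟩
  funext i
  fin_cases i
  exacts [key.1, key.2.1, key.2.2]

/-- The gradient map of Klein's quartic,
`[x : y : z] ↦ [3x²y + z³ : 3y²z + x³ : 3z²x + y³]`. -/
def gradientMap : P2 → P2 :=
  Projectivization.lift (fun v => Projectivization.mk ℂ (gradVec v) (gradVec_ne_zero v.2)) (by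
    intro a b t h
    rw [Projectivization.mk_eq_mk_iff']
    exact ⟨t ^ 3, by rw [h, gradVec_smul]⟩)

/-! ### The Klein group and its orbits -/

section group

variable {ζ : ℂ}

def matG (ζ : ℂ) : Matrix (Fin 3) (Fin 3) ℂ :=
  !![ζ ^ 4, 0, 0; 0, ζ ^ 2, 0; 0, 0, ζ]

def matH : Matrix (Fin 3) (Fin 3) ℂ :=
  !![0, 1, 0; 0, 0, 1; 1, 0, 0]

def matI (ζ : ℂ) : Matrix (Fin 3) (Fin 3) ℂ :=
  ((2 * ζ ^ 4 + 2 * ζ ^ 2 + 2 * ζ + 1) / 7) •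
    !![ζ - ζ ^ 6, ζ ^ 2 - ζ ^ 5, ζ ^ 4 - ζ ^ 3;
       ζ ^ 2 - ζ ^ 5, ζ ^ 4 - ζ ^ 3, ζ - ζ ^ 6;
       ζ ^ 4 - ζ ^ 3, ζ - ζ ^ 6, ζ ^ 2 - ζ ^ 5]

lemma cyclotomic_relation (hζ : IsPrimitiveRoot ζ 7) :
    ζ ^ 6 + ζ ^ 5 + ζ ^ 4 + ζ ^ 3 + ζ ^ 2 + ζ + 1 = 0 := by
  have := hζ.geom_sum_eq_zero (by norm_num)
  simp [Finset.sum_range_succ] at this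
  linear_combination this

lemma det_matG (hζ : IsPrimitiveRoot ζ 7) : (matG ζ).det = 1 := by
  rw [matG, Matrix.det_fin_three]
  simp
  linear_combination hζ.pow_eq_one

lemma det_matH : matH.det = 1 := by
  simp [matH, Matrix.det_fin_three]

lemma det_matI (hζ : IsPrimitiveRoot ζ 7) : (matI ζ).det = 1 := by
  rw [matI, Matrix.det_smul, Matrix.det_fin_three]
  simp
  linear_combination ((-343) + 343 * ζ - ζ ^ 3 - 5 * ζ ^ 4 - 12 * ζ ^ 5 - 18 * ζ ^ 6
    - 370 * ζ ^ 7 + 307 * ζ ^ 8 - 6 * ζ ^ 9 + 74 * ζ ^ 10 + 115 * ζ ^ 11 + 65 * ζ ^ 12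
    + 76 * ζ ^ 13 - 334 * ζ ^ 14 + 222 * ζ ^ 15 - 266 * ζ ^ 16 + 80 * ζ ^ 17 - 96 * ζ ^ 18
    + 108 * ζ ^ 19 - 44 * ζ ^ 20 + 32 * ζ ^ 21 + 24 * ζ ^ 22 - 8 * ζ ^ 23 + 8 * ζ ^ 24) / 343
    * cyclotomic_relation hζ

/-- The Klein group of order 168, as the subgroup of `SL₃(ℂ)` generated by the images of the
generators `g`, `h`, `i` under the three-dimensional representation attached to `ζ`. -/
def group (hζ : IsPrimitiveRoot ζ 7) : Subgroup (Matrix.SpecialLinearGroup (Fin 3) ℂ) :=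
  Subgroup.closure {⟨matG ζ, det_matG hζ⟩, ⟨matH, det_matH⟩, ⟨matI ζ, det_matI hζ⟩}

/-- The orbit of a point of the plane under the action `[v] ↦ [M v]` of the Klein group. -/
def orbit (hζ : IsPrimitiveRoot ζ 7) (p : P2) : Set P2 := MulAction.orbit (group hζ) p

/-- The orbit `O₂₈`: the orbit of `[1 : 1 : 1]`. -/
def O28 (hζ : IsPrimitiveRoot ζ 7) : Set P2 :=
  orbit hζ (Projectivization.mk ℂ ![1, 1, 1] (by simp))

/-- The orbit `O₅₆`: the orbit of `[ω² : ω : 1]`, where `ω` is a primitive cube root of 1. -/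
def O56 (hζ : IsPrimitiveRoot ζ 7) (ω : ℂ) : Set P2 :=
  orbit hζ (Projectivization.mk ℂ ![ω ^ 2, ω, 1] (by simp))

end group

/-! ### Ordinary triple points -/

/-- The polynomial `F (v + X)`, the Taylor expansion of `F` at `v`. -/
def translate (v : Fin 3 → ℂ) (F : S) : S := bind₁ (fun i => C (v i) + X i) F

/-- `p` is an ordinary triple point of the plane curve with homogeneous equation `F`: the
Taylor expansion of `F` at a vector `v` representing `p` has no terms of degree less than 3,
and its cubic part is a product of three pairwise non-proportional linear forms.
As `F` is homogeneous, this does not depend on the representative, and by Euler's formula the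
cubic part is constant in the direction of `v`; so it is the tangent cone of the curve at
`p`, and its factors are the equations of three distinct tangent lines at `p`. -/
def IsOrdinaryTriplePoint (F : S) (p : P2) : Prop :=
  (∀ k < 3, homogeneousComponent k (translate p.rep F) = 0) ∧
  ∃ a : Fin 3 → Fin 3 → ℂ,
    (∀ j k, j ≠ k → LinearIndependent ℂ ![a j, a k]) ∧
    homogeneousComponent 3 (translate p.rep F) = ∏ j, ∑ i, C (a j i) * X i

end

end Klein

/-!
The gradient map `∇` of Klein's quartic `Φ₄` has degree `3² = 9`. It intertwines the action of a
matrix `M` of the Klein group with that of its inverse transpose (`gradientMap_smul`), and the group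
is stable under the inverse transpose because its generators are orthogonal or diagonal
(`contragredient_mem`). So everything can be read off from the single fibre over `[1 : 1 : 1]`.

*The fibre.* In the coordinates `r, s, t` that diagonalise the cyclic permutation of the variables,
`Φ₄ = 3 (r⁴ + 3r²st + (1 + 3ω) rs³ + (1 + 3ω²) rt³ - 3s²t²)`, and the fibre is cut out by the
derivatives with respect to `s` and `t`. Its points are `[1 : 1 : 1]`, the two points with `r = 0`,
and three points for each root `e` of `14e² = 7e + 1` (`mem_fibre_iff`). The permutation and the
involution `matI` move points within these four blocks, of sizes 1, 2, 3, 3, while the values of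
`Φ₄³ / Φ₆²` on the blocks differ; so every orbit meets the fibre in one block
(`orbit_pointP_inter_fibre`, `orbit_pointQ_inter_fibre`, `orbit_inter_fibre`).

*The orbits.* An orbit that meets the fibre in `n` points has `28 n` points (`ncard_orbit`), once
the orbit of `[1 : 1 : 1]` is known to have 28. The latter splits into 7 points, permuted by the
diagonal generator, and 21 points, permuted simply transitively by the subgroup of order 21, and one checks
that `matI` preserves the union of the two sets (`O28_eq`, `ncard_O28`).

*The singularities.* The forms `Φ₆`, `Φ₁₄`, `Φ₂₁` are covariants of `Φ₄`, hence invariant under the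
group. At `(1, 1, 1)` an expansion of `Φ₂₁` shows that its tangent cone is a combination with
non-zero coefficients of the cubes of two independent linear forms, thus three distinct lines
(`isTripleVec_Phi21_one`). By invariance the same holds on the whole orbit. Since `Φ₆`, a multiple
of the Hessian determinant, does not vanish on the preimage of the orbit, `∇` is a local isomorphism
there, and the tangent cone of `Φ₆₃ = Φ₂₁ ∘ ∇` is the pullback of that of `Φ₂₁` under the Hessian
matrix (`isTripleVec_Phi63`).
-/

namespace Klein

noncomputable section

/-! ### Linear substitutions and covariants -/

/-- The linear substitution `F ↦ F ∘ M` on ternary forms, as an algebra endomorphism. -/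
def subst (M : Matrix (Fin 3) (Fin 3) ℂ) : S →ₐ[ℂ] S :=
  bind₁ fun i => ∑ j, C (M i j) * X j

lemma aeval_subst {A : Type*} [CommRing A] [Algebra ℂ A] (M : Matrix (Fin 3) (Fin 3) ℂ)
    (v : Fin 3 → A) (F : S) :
    aeval v (subst M F) = aeval (fun i => ∑ j, algebraMap ℂ A (M i j) * v j) F := by
  rw [subst, aeval_bind₁]
  simp

lemma eval_subst (M : Matrix (Fin 3) (Fin 3) ℂ) (v : Fin 3 → ℂ) (F : S) :
    eval v (subst M F) = eval (M.mulVec v) F := by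
  have := aeval_subst M v F
  simp only [aeval_eq_eval] at this
  exact this

/-- The chain rule for linear substitutions. -/
lemma pderiv_subst (M : Matrix (Fin 3) (Fin 3) ℂ) (k : Fin 3) (F : S) :
    pderiv k (subst M F) = ∑ i, C (M i k) * subst M (pderiv i F) := by
  induction F using MvPolynomial.induction_on with
  | C a => simp [subst]
  | add p q hp hq => simp [hp, hq, mul_add, Finset.sum_add_distrib]
  | mul_X p n hp =>
    have hX : pderiv k (subst M (X n)) = C (M n k) := by
      simp [subst, pderiv_X, Pi.single_apply]
    have h1 : ∀ i, subst M (pderiv i (p * X n)) =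
        (if i = n then subst M p else 0) + subst M (X n) * subst M (pderiv i p) := fun i => by
      rw [Derivation.leibniz, pderiv_X, smul_eq_mul, smul_eq_mul, map_add, map_mul, map_mul]
      by_cases h : i = n
      · rw [h, Pi.single_eq_same, map_one, mul_one, if_pos rfl]
      · rw [Pi.single_eq_of_ne (Ne.symm h), map_zero, mul_zero, if_neg h]
    rw [map_mul, Derivation.leibniz, hp, hX, smul_eq_mul, smul_eq_mul, Finset.mul_sum]
    simp only [h1, mul_add, Finset.sum_add_distrib, mul_ite, mul_zero, Finset.sum_ite_eq',
      Finset.mem_univ, if_true]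
    rw [mul_comm (subst M p)]
    refine congrArg _ (Finset.sum_congr rfl fun i _ => ?_)
    rw [mul_left_comm]

lemma hessian_subst {F : S} (M : Matrix (Fin 3) (Fin 3) ℂ) :
    hessian (subst M F) = (M.map C).transpose * (hessian F).map (subst M) * M.map C := by
  ext1 i j
  simp only [hessian, Matrix.of_apply, pderiv_subst, map_sum, Derivation.leibniz, pderiv_C,
    Matrix.mul_apply, Matrix.transpose_apply, Matrix.map_apply, smul_eq_mul, Finset.sum_mul,
    add_zero, mul_zero, Finset.mul_sum]
  refine Finset.sum_congr rfl fun a _ => Finset.sum_congr rfl fun b _ => ?_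
  ring

lemma det_map_C (M : Matrix (Fin 3) (Fin 3) ℂ) : (M.map (C : ℂ →+* S)).det = C M.det :=
  ((C : ℂ →+* S).map_det M).symm

lemma det_map_subst {n : Type*} [Fintype n] [DecidableEq n] (N : Matrix n n S)
    (M : Matrix (Fin 3) (Fin 3) ℂ) : (N.map (subst M)).det = subst M N.det :=
  ((subst M).map_det N).symm

lemma det_hessian_subst {M : Matrix (Fin 3) (Fin 3) ℂ} (hM : M.det = 1) (F : S) :
    (hessian (subst M F)).det = subst M (hessian F).det := by
  rw [hessian_subst, Matrix.det_mul, Matrix.det_mul, Matrix.det_transpose, det_map_C, hM,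
    det_map_subst]
  simp

lemma borderedHessian_subst {M : Matrix (Fin 3) (Fin 3) ℂ} (hM : M.det = 1) (F H : S) :
    borderedHessian (subst M F) (subst M H) = subst M (borderedHessian F H) := by
  have key : Matrix.fromBlocks (hessian (subst M F))
      (Matrix.of fun i (_ : Fin 1) => pderiv i (subst M H))
      (Matrix.of fun (_ : Fin 1) j => pderiv j (subst M H)) 0 =
      Matrix.fromBlocks (M.map (C : ℂ →+* S)).transpose 0 0 (1 : Matrix (Fin 1) (Fin 1) S) *
      (Matrix.fromBlocks (hessian F) (Matrix.of fun i (_ : Fin 1) => pderiv i H)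
        (Matrix.of fun (_ : Fin 1) j => pderiv j H) 0).map (subst M) *
      Matrix.fromBlocks (M.map (C : ℂ →+* S)) 0 0 (1 : Matrix (Fin 1) (Fin 1) S) := by
    rw [Matrix.fromBlocks_map, Matrix.fromBlocks_multiply, Matrix.fromBlocks_multiply]
    congr 1
    · simp [hessian_subst]
    · ext1 i j
      simp [pderiv_subst, Matrix.mul_apply]
    · ext1 i j
      simp [pderiv_subst, Matrix.mul_apply, mul_comm]
    · ext1 i j
      simp
  rw [borderedHessian, key, Matrix.det_mul, Matrix.det_mul, det_map_subst,
    Matrix.det_fromBlocks_zero₂₁, Matrix.det_fromBlocks_zero₂₁, Matrix.det_transpose, det_map_C,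
    hM, borderedHessian]
  simp

lemma jacobian_subst {M : Matrix (Fin 3) (Fin 3) ℂ} (hM : M.det = 1) (F : Fin 3 → S) :
    jacobian (fun i => subst M (F i)) = subst M (jacobian F) := by
  have key : (Matrix.of fun i j => pderiv j (subst M (F i))) =
      (Matrix.of fun i j => pderiv j (F i)).map (subst M) * M.map (C : ℂ →+* S) := by
    ext1 i j
    simp [pderiv_subst, Matrix.mul_apply, mul_comm]
  rw [jacobian, key, Matrix.det_mul, det_map_subst, det_map_C, hM, jacobian]
  simp

lemma subst_Phi6 {M : Matrix (Fin 3) (Fin 3) ℂ} (hM : M.det = 1)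
    (h4 : subst M Phi4 = Phi4) : subst M Phi6 = Phi6 := by
  rw [Phi6, map_mul, ← det_hessian_subst hM, h4]
  simp [subst]

lemma subst_Phi14 {M : Matrix (Fin 3) (Fin 3) ℂ} (hM : M.det = 1)
    (h4 : subst M Phi4 = Phi4) : subst M Phi14 = Phi14 := by
  rw [Phi14, map_mul, ← borderedHessian_subst hM, h4, subst_Phi6 hM h4]
  simp [subst]

lemma subst_Phi21 {M : Matrix (Fin 3) (Fin 3) ℂ} (hM : M.det = 1)
    (h4 : subst M Phi4 = Phi4) : subst M Phi21 = Phi21 := by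
  have : (fun i => subst M (![Phi4, Phi6, Phi14] i)) = ![Phi4, Phi6, Phi14] := by
    funext i
    fin_cases i
    exacts [h4, subst_Phi6 hM h4, subst_Phi14 hM h4]
  rw [Phi21, map_mul, ← jacobian_subst hM, this]
  simp [subst]

/-- The gradient map intertwines `M` with its inverse transpose. -/
lemma transpose_mulVec_gradVec {M : Matrix (Fin 3) (Fin 3) ℂ}
    (h4 : subst M Phi4 = Phi4) (v : Fin 3 → ℂ) :
    M.transpose.mulVec (gradVec (M.mulVec v)) = gradVec v := by
  funext k
  have := congrArg (eval v) (pderiv_subst M k Phi4)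
  rw [h4] at this
  simp only [gradVec, Matrix.mulVec, dotProduct, Matrix.transpose_apply]
  rw [this, map_sum]
  refine Finset.sum_congr rfl fun i _ => ?_
  rw [map_mul, eval_C, eval_subst]

/-! ### Explicit equations of the invariants -/

lemma pderiv_ofNat (i : Fin 3) (n : ℕ) [n.AtLeastTwo] :
    pderiv i (ofNat(n) : S) = 0 :=
  Derivation.map_natCast _ n

lemma C_mul_eq {a : ℂ} {n : ℕ} [n.AtLeastTwo] (h : a * ofNat(n) = 1) {F E : S}
    (hF : F = ofNat(n) * E) : C a * F = E := by
  rw [hF, ← mul_assoc, ← map_ofNat (C : ℂ →+* S) n, ← C_mul, h, C_1, one_mul]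

lemma Phi4_eq : Phi4 =
    X 0 ^ 3 * X 1 + X 0 * X 2 ^ 3 + X 1 ^ 3 * X 2 := by
  rw [Phi4]
  ring

lemma pderiv_Phi4_0 : pderiv 0 Phi4 =
    3 * X 0 ^ 2 * X 1 + X 2 ^ 3 := by
  rw [Phi4_eq]
  simp only [map_add, Derivation.leibniz, Derivation.leibniz_pow, pderiv_X, Pi.single_eq_same,
    Pi.single_eq_of_ne, ne_eq, Fin.reduceEq, not_false_eq_true, nsmul_eq_mul, smul_eq_mul,
    Nat.cast_ofNat, mul_zero, add_zero, zero_add, mul_one]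
  ring

lemma pderiv_Phi4_1 : pderiv 1 Phi4 =
    X 0 ^ 3 + 3 * X 1 ^ 2 * X 2 := by
  rw [Phi4_eq]
  simp only [map_add, Derivation.leibniz, Derivation.leibniz_pow, pderiv_X, Pi.single_eq_same,
    Pi.single_eq_of_ne, ne_eq, Fin.reduceEq, not_false_eq_true, nsmul_eq_mul, smul_eq_mul,
    Nat.cast_ofNat, mul_zero, add_zero, zero_add, mul_one]
  ring

lemma pderiv_Phi4_2 : pderiv 2 Phi4 =
    3 * X 0 * X 2 ^ 2 + X 1 ^ 3 := by
  rw [Phi4_eq]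
  simp only [map_add, Derivation.leibniz, Derivation.leibniz_pow, pderiv_X, Pi.single_eq_same,
    Pi.single_eq_of_ne, ne_eq, Fin.reduceEq, not_false_eq_true, nsmul_eq_mul, smul_eq_mul,
    Nat.cast_ofNat, mul_zero, add_zero, zero_add, mul_one]
  ring

lemma hessian_Phi4 : hessian Phi4 =
    !![6 * X 0 * X 1, 3 * X 0 ^ 2, 3 * X 2 ^ 2;
      3 * X 0 ^ 2, 6 * X 1 * X 2, 3 * X 1 ^ 2;
      3 * X 2 ^ 2, 3 * X 1 ^ 2, 6 * X 0 * X 2] := by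
  ext1 i j
  fin_cases i <;> fin_cases j <;> simp [hessian, Phi4, pderiv_X, pderiv_ofNat] <;> ring

lemma Phi6_eq : Phi6 =
    X 0 ^ 5 * X 2 - 5 * X 0 ^ 2 * X 1 ^ 2 * X 2 ^ 2 + X 0 * X 1 ^ 5 + X 1 * X 2 ^ 5 := by
  rw [Phi6, show (-1 / 54 : ℂ) = -(1 / 54) by norm_num, C_neg, neg_mul, ← mul_neg]
  refine C_mul_eq (n := 54) (by norm_num) ?_
  rw [hessian_Phi4, Matrix.det_fin_three]
  simp
  ring

lemma pderiv_Phi6_0 : pderiv 0 Phi6 =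
    5 * X 0 ^ 4 * X 2 - 10 * X 0 * X 1 ^ 2 * X 2 ^ 2 + X 1 ^ 5 := by
  rw [Phi6_eq]
  simp only [map_add, map_sub, Derivation.leibniz, Derivation.leibniz_pow, pderiv_ofNat,
    pderiv_X, Pi.single_eq_same, Pi.single_eq_of_ne, ne_eq, Fin.reduceEq, not_false_eq_true,
    nsmul_eq_mul, smul_eq_mul, Nat.cast_ofNat, mul_zero, add_zero, zero_add, mul_one]
  ring

lemma pderiv_Phi6_1 : pderiv 1 Phi6 =
    -10 * X 0 ^ 2 * X 1 * X 2 ^ 2 + 5 * X 0 * X 1 ^ 4 + X 2 ^ 5 := by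
  rw [Phi6_eq]
  simp only [map_add, map_sub, Derivation.leibniz, Derivation.leibniz_pow, pderiv_ofNat,
    pderiv_X, Pi.single_eq_same, Pi.single_eq_of_ne, ne_eq, Fin.reduceEq, not_false_eq_true,
    nsmul_eq_mul, smul_eq_mul, Nat.cast_ofNat, mul_zero, add_zero, zero_add, mul_one]
  ring

lemma pderiv_Phi6_2 : pderiv 2 Phi6 =
    X 0 ^ 5 - 10 * X 0 ^ 2 * X 1 ^ 2 * X 2 + 5 * X 1 * X 2 ^ 4 := by
  rw [Phi6_eq]
  simp only [map_add, map_sub, Derivation.leibniz, Derivation.leibniz_pow, pderiv_ofNat,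
    pderiv_X, Pi.single_eq_same, Pi.single_eq_of_ne, ne_eq, Fin.reduceEq, not_false_eq_true,
    nsmul_eq_mul, smul_eq_mul, Nat.cast_ofNat, mul_zero, add_zero, mul_one]
  ring

/-- The bordered Hessian as the quadratic form of the adjugate of the Hessian matrix. -/
lemma borderedHessian_eq (F H : S) : borderedHessian F H =
    -(∑ i, ∑ j, pderiv i H * (hessian F).adjugate i j * pderiv j H) := by
  have h : (Matrix.fromBlocks (hessian F) (Matrix.of fun i (_ : Fin 1) => pderiv i H)
      (Matrix.of fun (_ : Fin 1) j => pderiv j H) 0).submatrix finSumFinEquiv.symm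
        finSumFinEquiv.symm =
      !![hessian F 0 0, hessian F 0 1, hessian F 0 2, pderiv 0 H;
        hessian F 1 0, hessian F 1 1, hessian F 1 2, pderiv 1 H;
        hessian F 2 0, hessian F 2 1, hessian F 2 2, pderiv 2 H;
        pderiv 0 H, pderiv 1 H, pderiv 2 H, 0] := by
    ext1 i j
    fin_cases i <;> fin_cases j <;> rfl
  rw [borderedHessian, ← Matrix.det_submatrix_equiv_self finSumFinEquiv.symm, h]
  simp [Matrix.det_succ_row_zero, Fin.sum_univ_succ, Matrix.adjugate_fin_three, Fin.succAbove]
  ring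

set_option maxHeartbeats 1000000 in
lemma Phi14_eq : Phi14 =
    X 0 ^ 14 - 34 * X 0 ^ 11 * X 1 ^ 2 * X 2 - 250 * X 0 ^ 9 * X 1 * X 2 ^ 4
    + 375 * X 0 ^ 8 * X 1 ^ 4 * X 2 ^ 2 + 18 * X 0 ^ 7 * X 1 ^ 7 + 18 * X 0 ^ 7 * X 2 ^ 7
    - 126 * X 0 ^ 6 * X 1 ^ 3 * X 2 ^ 5 - 126 * X 0 ^ 5 * X 1 ^ 6 * X 2 ^ 3
    - 250 * X 0 ^ 4 * X 1 ^ 9 * X 2 + 375 * X 0 ^ 4 * X 1 ^ 2 * X 2 ^ 8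
    - 126 * X 0 ^ 3 * X 1 ^ 5 * X 2 ^ 6 + 375 * X 0 ^ 2 * X 1 ^ 8 * X 2 ^ 4
    - 34 * X 0 ^ 2 * X 1 * X 2 ^ 11 - 34 * X 0 * X 1 ^ 11 * X 2 ^ 2
    - 250 * X 0 * X 1 ^ 4 * X 2 ^ 9 + X 1 ^ 14 + 18 * X 1 ^ 7 * X 2 ^ 7 + X 2 ^ 14 := by
  rw [Phi14]
  refine C_mul_eq (n := 9) (by norm_num) ?_
  rw [borderedHessian_eq, hessian_Phi4, Matrix.adjugate_fin_three]
  simp only [Fin.sum_univ_three, pderiv_Phi6_0, pderiv_Phi6_1, pderiv_Phi6_2, Matrix.of_apply,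
    Matrix.cons_val]
  ring

lemma pderiv_Phi14_0 : pderiv 0 Phi14 =
    14 * X 0 ^ 13 - 374 * X 0 ^ 10 * X 1 ^ 2 * X 2 - 2250 * X 0 ^ 8 * X 1 * X 2 ^ 4
    + 3000 * X 0 ^ 7 * X 1 ^ 4 * X 2 ^ 2 + 126 * X 0 ^ 6 * X 1 ^ 7 + 126 * X 0 ^ 6 * X 2 ^ 7
    - 756 * X 0 ^ 5 * X 1 ^ 3 * X 2 ^ 5 - 630 * X 0 ^ 4 * X 1 ^ 6 * X 2 ^ 3
    - 1000 * X 0 ^ 3 * X 1 ^ 9 * X 2 + 1500 * X 0 ^ 3 * X 1 ^ 2 * X 2 ^ 8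
    - 378 * X 0 ^ 2 * X 1 ^ 5 * X 2 ^ 6 + 750 * X 0 * X 1 ^ 8 * X 2 ^ 4
    - 68 * X 0 * X 1 * X 2 ^ 11 - 34 * X 1 ^ 11 * X 2 ^ 2 - 250 * X 1 ^ 4 * X 2 ^ 9 := by
  rw [Phi14_eq]
  simp only [map_add, map_sub, Derivation.leibniz, Derivation.leibniz_pow, pderiv_ofNat,
    pderiv_X, Pi.single_eq_same, Pi.single_eq_of_ne, ne_eq, Fin.reduceEq, not_false_eq_true,
    nsmul_eq_mul, smul_eq_mul, Nat.cast_ofNat, mul_zero, add_zero, zero_add, mul_one]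
  ring

lemma pderiv_Phi14_1 : pderiv 1 Phi14 =
    -68 * X 0 ^ 11 * X 1 * X 2 - 250 * X 0 ^ 9 * X 2 ^ 4 + 1500 * X 0 ^ 8 * X 1 ^ 3 * X 2 ^ 2
    + 126 * X 0 ^ 7 * X 1 ^ 6 - 378 * X 0 ^ 6 * X 1 ^ 2 * X 2 ^ 5
    - 756 * X 0 ^ 5 * X 1 ^ 5 * X 2 ^ 3 - 2250 * X 0 ^ 4 * X 1 ^ 8 * X 2
    + 750 * X 0 ^ 4 * X 1 * X 2 ^ 8 - 630 * X 0 ^ 3 * X 1 ^ 4 * X 2 ^ 6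
    + 3000 * X 0 ^ 2 * X 1 ^ 7 * X 2 ^ 4 - 34 * X 0 ^ 2 * X 2 ^ 11
    - 374 * X 0 * X 1 ^ 10 * X 2 ^ 2 - 1000 * X 0 * X 1 ^ 3 * X 2 ^ 9 + 14 * X 1 ^ 13
    + 126 * X 1 ^ 6 * X 2 ^ 7 := by
  rw [Phi14_eq]
  simp only [map_add, map_sub, Derivation.leibniz, Derivation.leibniz_pow, pderiv_ofNat,
    pderiv_X, Pi.single_eq_same, Pi.single_eq_of_ne, ne_eq, Fin.reduceEq, not_false_eq_true,
    nsmul_eq_mul, smul_eq_mul, Nat.cast_ofNat, mul_zero, add_zero, zero_add, mul_one]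
  ring

lemma pderiv_Phi14_2 : pderiv 2 Phi14 =
    -34 * X 0 ^ 11 * X 1 ^ 2 - 1000 * X 0 ^ 9 * X 1 * X 2 ^ 3 + 750 * X 0 ^ 8 * X 1 ^ 4 * X 2
    + 126 * X 0 ^ 7 * X 2 ^ 6 - 630 * X 0 ^ 6 * X 1 ^ 3 * X 2 ^ 4
    - 378 * X 0 ^ 5 * X 1 ^ 6 * X 2 ^ 2 - 250 * X 0 ^ 4 * X 1 ^ 9
    + 3000 * X 0 ^ 4 * X 1 ^ 2 * X 2 ^ 7 - 756 * X 0 ^ 3 * X 1 ^ 5 * X 2 ^ 5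
    + 1500 * X 0 ^ 2 * X 1 ^ 8 * X 2 ^ 3 - 374 * X 0 ^ 2 * X 1 * X 2 ^ 10
    - 68 * X 0 * X 1 ^ 11 * X 2 - 2250 * X 0 * X 1 ^ 4 * X 2 ^ 8 + 126 * X 1 ^ 7 * X 2 ^ 6
    + 14 * X 2 ^ 13 := by
  rw [Phi14_eq]
  simp only [map_add, map_sub, Derivation.leibniz, Derivation.leibniz_pow, pderiv_ofNat,
    pderiv_X, Pi.single_eq_same, Pi.single_eq_of_ne, ne_eq, Fin.reduceEq, not_false_eq_true,
    nsmul_eq_mul, smul_eq_mul, Nat.cast_ofNat, mul_zero, add_zero, mul_one]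
  ring

set_option maxHeartbeats 2000000 in
lemma Phi21_eq : Phi21 =
    X 0 ^ 21 - 7 * X 0 ^ 18 * X 1 ^ 2 * X 2 + 217 * X 0 ^ 16 * X 1 * X 2 ^ 4
    - 308 * X 0 ^ 15 * X 1 ^ 4 * X 2 ^ 2 - 57 * X 0 ^ 14 * X 1 ^ 7 - 289 * X 0 ^ 14 * X 2 ^ 7
    + 4018 * X 0 ^ 13 * X 1 ^ 3 * X 2 ^ 5 + 637 * X 0 ^ 12 * X 1 ^ 6 * X 2 ^ 3
    + 1638 * X 0 ^ 11 * X 1 ^ 9 * X 2 - 6279 * X 0 ^ 11 * X 1 ^ 2 * X 2 ^ 8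
    + 7007 * X 0 ^ 10 * X 1 ^ 5 * X 2 ^ 6 - 10010 * X 0 ^ 9 * X 1 ^ 8 * X 2 ^ 4
    + 1638 * X 0 ^ 9 * X 1 * X 2 ^ 11 - 6279 * X 0 ^ 8 * X 1 ^ 11 * X 2 ^ 2
    - 10010 * X 0 ^ 8 * X 1 ^ 4 * X 2 ^ 9 - 289 * X 0 ^ 7 * X 1 ^ 14
    + 10296 * X 0 ^ 7 * X 1 ^ 7 * X 2 ^ 7 - 57 * X 0 ^ 7 * X 2 ^ 14
    + 7007 * X 0 ^ 6 * X 1 ^ 10 * X 2 ^ 5 + 637 * X 0 ^ 6 * X 1 ^ 3 * X 2 ^ 12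
    + 4018 * X 0 ^ 5 * X 1 ^ 13 * X 2 ^ 3 + 7007 * X 0 ^ 5 * X 1 ^ 6 * X 2 ^ 10
    + 217 * X 0 ^ 4 * X 1 ^ 16 * X 2 - 10010 * X 0 ^ 4 * X 1 ^ 9 * X 2 ^ 8
    - 308 * X 0 ^ 4 * X 1 ^ 2 * X 2 ^ 15 + 637 * X 0 ^ 3 * X 1 ^ 12 * X 2 ^ 6
    + 4018 * X 0 ^ 3 * X 1 ^ 5 * X 2 ^ 13 - 308 * X 0 ^ 2 * X 1 ^ 15 * X 2 ^ 4
    - 6279 * X 0 ^ 2 * X 1 ^ 8 * X 2 ^ 11 - 7 * X 0 ^ 2 * X 1 * X 2 ^ 18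
    - 7 * X 0 * X 1 ^ 18 * X 2 ^ 2 + 1638 * X 0 * X 1 ^ 11 * X 2 ^ 9
    + 217 * X 0 * X 1 ^ 4 * X 2 ^ 16 + X 1 ^ 21 - 57 * X 1 ^ 14 * X 2 ^ 7
    - 289 * X 1 ^ 7 * X 2 ^ 14 + X 2 ^ 21 := by
  rw [Phi21]
  refine C_mul_eq (n := 14) (by norm_num) ?_
  rw [jacobian, Matrix.det_fin_three]
  simp only [Matrix.of_apply, Matrix.cons_val, pderiv_Phi4_0, pderiv_Phi4_1, pderiv_Phi4_2,
    pderiv_Phi6_0, pderiv_Phi6_1, pderiv_Phi6_2, pderiv_Phi14_0, pderiv_Phi14_1, pderiv_Phi14_2]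
  ring

/-! ### Invariance under the Klein group and equivariance of the gradient map -/

lemma subst_eq_self {M : Matrix (Fin 3) (Fin 3) ℂ} {F : S}
    (h : ∀ v, eval (M.mulVec v) F = eval v F) : subst M F = F :=
  MvPolynomial.funext fun v => by rw [eval_subst, h]

/-- The first entry of the involution `matI ζ`; it is a root of `7t³ + 7t² = 1`, and the other
two entries of the matrix are the other roots. -/
def alpha (ζ : ℂ) : ℂ := (-1 + 3 * ζ ^ 2 + ζ ^ 3 + ζ ^ 4 + 3 * ζ ^ 5) / 7

/-- The second entry of the involution `matI ζ`, as a polynomial in the first one. -/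
def beta (ζ : ℂ) : ℂ := 7 * alpha ζ ^ 2 + 2 * alpha ζ - 2

/-- The third entry of the involution `matI ζ`, as a polynomial in the first one. -/
def gamma (ζ : ℂ) : ℂ := 1 - 3 * alpha ζ - 7 * alpha ζ ^ 2

variable {ζ : ℂ}

lemma alpha_cubic (hζ : IsPrimitiveRoot ζ 7) : 7 * alpha ζ ^ 3 + 7 * alpha ζ ^ 2 = 1 := by
  have h := cyclotomic_relation hζ
  unfold alpha
  grind

lemma matI_eq (hζ : IsPrimitiveRoot ζ 7) : matI ζ =
    !![alpha ζ, beta ζ, gamma ζ; beta ζ, gamma ζ, alpha ζ; gamma ζ, alpha ζ, beta ζ] := by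
  have h := cyclotomic_relation hζ
  have ha : (2 * ζ ^ 4 + 2 * ζ ^ 2 + 2 * ζ + 1) / 7 * (ζ - ζ ^ 6) = alpha ζ := by
    unfold alpha
    grind
  have hb : (2 * ζ ^ 4 + 2 * ζ ^ 2 + 2 * ζ + 1) / 7 * (ζ ^ 2 - ζ ^ 5) = beta ζ := by
    unfold beta alpha
    grind
  have hc : (2 * ζ ^ 4 + 2 * ζ ^ 2 + 2 * ζ + 1) / 7 * (ζ ^ 4 - ζ ^ 3) = gamma ζ := by
    unfold gamma alpha
    grind
  rw [matI, Matrix.smul_of]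
  simp [ha, hb, hc]

lemma subst_matG (hζ : IsPrimitiveRoot ζ 7) : subst (matG ζ) Phi4 = Phi4 := by
  refine subst_eq_self fun v => ?_
  have h := hζ.pow_eq_one
  simp [Phi4, matG, dotProduct, Fin.sum_univ_three]
  grind

lemma subst_matH : subst matH Phi4 = Phi4 := by
  refine subst_eq_self fun v => ?_
  simp [Phi4, matH, dotProduct, Fin.sum_univ_three]
  ring

lemma subst_matI (hζ : IsPrimitiveRoot ζ 7) : subst (matI ζ) Phi4 = Phi4 := by
  refine subst_eq_self fun v => ?_
  have h := alpha_cubic hζ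
  rw [matI_eq hζ]
  simp [Phi4, dotProduct, Fin.sum_univ_three, beta, gamma]
  generalize v 0 = x
  generalize v 1 = y
  generalize v 2 = z
  generalize alpha ζ = a at h ⊢
  grind

/-- The first generator of the Klein group, as an element of `SL₃(ℂ)`. -/
def genG (hζ : IsPrimitiveRoot ζ 7) : Matrix.SpecialLinearGroup (Fin 3) ℂ :=
  ⟨matG ζ, det_matG hζ⟩

/-- The second generator of the Klein group, as an element of `SL₃(ℂ)`. -/
def genH : Matrix.SpecialLinearGroup (Fin 3) ℂ := ⟨matH, det_matH⟩

/-- The third generator of the Klein group, as an element of `SL₃(ℂ)`. -/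
def genI (hζ : IsPrimitiveRoot ζ 7) : Matrix.SpecialLinearGroup (Fin 3) ℂ :=
  ⟨matI ζ, det_matI hζ⟩

lemma genG_mem (hζ : IsPrimitiveRoot ζ 7) : genG hζ ∈ group hζ :=
  Subgroup.subset_closure (Or.inl rfl)

lemma genH_mem (hζ : IsPrimitiveRoot ζ 7) : genH ∈ group hζ :=
  Subgroup.subset_closure (Or.inr (Or.inl rfl))

lemma genI_mem (hζ : IsPrimitiveRoot ζ 7) : genI hζ ∈ group hζ :=
  Subgroup.subset_closure (Or.inr (Or.inr rfl))

lemma group_le {hζ : IsPrimitiveRoot ζ 7} {K : Subgroup (Matrix.SpecialLinearGroup (Fin 3) ℂ)}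
    (hG : genG hζ ∈ K) (hH : genH ∈ K) (hI : genI hζ ∈ K) : group hζ ≤ K := by
  rw [group, Subgroup.closure_le]
  rintro M (rfl | rfl | rfl)
  exacts [hG, hH, hI]

/-- Matrices in `SL₃(ℂ)` that leave Klein's quartic invariant. -/
def invarianceGroup : Subgroup (Matrix.SpecialLinearGroup (Fin 3) ℂ) where
  carrier := {M | ∀ v, eval (M • v) Phi4 = eval v Phi4}
  one_mem' v := by rw [one_smul]
  mul_mem' {M N} hM hN v := by rw [mul_smul, hM, hN]
  inv_mem' {M} hM v := by rw [← hM, smul_inv_smul]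

lemma mem_invarianceGroup {M : Matrix.SpecialLinearGroup (Fin 3) ℂ}
    (h : subst M.1 Phi4 = Phi4) : M ∈ invarianceGroup := fun v => by
  conv_rhs => rw [← h]
  exact (eval_subst M.1 v Phi4).symm

lemma subst_Phi4 {hζ : IsPrimitiveRoot ζ 7} {M : Matrix.SpecialLinearGroup (Fin 3) ℂ}
    (hM : M ∈ group hζ) : subst M.1 Phi4 = Phi4 := by
  have h : group hζ ≤ invarianceGroup :=
    group_le (mem_invarianceGroup (subst_matG hζ)) (mem_invarianceGroup subst_matH)
      (mem_invarianceGroup (subst_matI hζ))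
  exact subst_eq_self (h hM)

/-- The inverse transpose, as an endomorphism of `SL₃(ℂ)`. -/
def contragredient :
    Matrix.SpecialLinearGroup (Fin 3) ℂ →* Matrix.SpecialLinearGroup (Fin 3) ℂ where
  toFun M := M⁻¹.transpose
  map_one' := by
    ext i j
    simp [Matrix.SpecialLinearGroup.transpose]
  map_mul' M N := by
    rw [mul_inv_rev]
    refine Subtype.ext ?_
    simp only [Matrix.SpecialLinearGroup.coe_transpose, Matrix.SpecialLinearGroup.coe_mul,
      Matrix.transpose_mul]

lemma contragredient_apply (M : Matrix.SpecialLinearGroup (Fin 3) ℂ) :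
    contragredient M = M⁻¹.transpose := rfl

lemma transpose_mul_contragredient (M : Matrix.SpecialLinearGroup (Fin 3) ℂ) :
    M.transpose * contragredient M = 1 := by
  refine Subtype.ext ?_
  rw [contragredient_apply, Matrix.SpecialLinearGroup.coe_mul,
    Matrix.SpecialLinearGroup.coe_transpose, Matrix.SpecialLinearGroup.coe_transpose,
    ← Matrix.transpose_mul, ← Matrix.SpecialLinearGroup.coe_mul, inv_mul_cancel]
  simp

lemma contragredient_eq {M N : Matrix.SpecialLinearGroup (Fin 3) ℂ}
    (h : M.1.transpose * N.1 = 1) : contragredient M = N := by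
  have h1 : M.transpose * N = 1 := Subtype.ext h
  exact mul_left_cancel ((transpose_mul_contragredient M).trans h1.symm)

lemma contragredient_contragredient (M : Matrix.SpecialLinearGroup (Fin 3) ℂ) :
    contragredient (contragredient M) = M := by
  refine contragredient_eq ?_
  rw [contragredient_apply, Matrix.SpecialLinearGroup.coe_transpose, Matrix.transpose_transpose]
  exact congrArg Subtype.val (inv_mul_cancel M)

lemma genG_pow_apply (hζ : IsPrimitiveRoot ζ 7) (n : ℕ) : (genG hζ ^ n).1 =
    Matrix.diagonal ![ζ ^ (4 * n), ζ ^ (2 * n), ζ ^ n] := by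
  have h : matG ζ = Matrix.diagonal ![ζ ^ 4, ζ ^ 2, ζ] := by
    ext1 i j
    fin_cases i <;> fin_cases j <;> simp [matG]
  change matG ζ ^ n = _
  rw [h, Matrix.diagonal_pow]
  congr 1
  funext i
  fin_cases i <;> simp [pow_mul]

lemma genG_pow (hζ : IsPrimitiveRoot ζ 7) : genG hζ ^ 7 = 1 := by
  refine Subtype.ext ?_
  rw [genG_pow_apply, mul_comm 4, mul_comm 2, pow_mul, pow_mul, hζ.pow_eq_one]
  ext1 i j
  fin_cases i <;> fin_cases j <;> simp

lemma genH_pow : genH ^ 3 = 1 := by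
  refine Subtype.ext ?_
  change matH ^ 3 = 1
  ext1 i j
  fin_cases i <;> fin_cases j <;> simp [matH, pow_three, Matrix.mul_apply, Fin.sum_univ_three]

lemma genG_mul_genH (hζ : IsPrimitiveRoot ζ 7) : genG hζ * genH = genH * genG hζ ^ 2 := by
  have h := hζ.pow_eq_one
  refine Subtype.ext ?_
  rw [Matrix.SpecialLinearGroup.coe_mul, Matrix.SpecialLinearGroup.coe_mul, genG_pow_apply]
  change matG ζ * matH = matH * _
  ext1 i j
  fin_cases i <;> fin_cases j <;> simp [matG, matH, Matrix.mul_apply, Fin.sum_univ_three]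
  grind

lemma genI_mul_genH (hζ : IsPrimitiveRoot ζ 7) : genI hζ * genH = genH ^ 2 * genI hζ := by
  refine Subtype.ext ?_
  change matI ζ * matH = matH ^ 2 * matI ζ
  rw [matI_eq hζ]
  ext1 i j
  fin_cases i <;> fin_cases j <;> simp [matH, pow_two, Matrix.mul_apply, Fin.sum_univ_three]

lemma genI_sq (hζ : IsPrimitiveRoot ζ 7) : genI hζ * genI hζ = 1 := by
  have h := alpha_cubic hζ
  refine Subtype.ext ?_
  change matI ζ * matI ζ = 1
  rw [matI_eq hζ]
  ext1 i j
  fin_cases i <;> fin_cases j <;>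
  · simp [Matrix.mul_apply, Fin.sum_univ_three, beta, gamma]
    grind

/-- The Klein group is stable under the inverse transpose. -/
lemma contragredient_mem {hζ : IsPrimitiveRoot ζ 7} {M : Matrix.SpecialLinearGroup (Fin 3) ℂ}
    (hM : M ∈ group hζ) : contragredient M ∈ group hζ := by
  have h : group hζ ≤ (group hζ).comap contragredient := by
    refine group_le ?_ ?_ ?_ <;> rw [Subgroup.mem_comap]
    · have : contragredient (genG hζ) = (genG hζ)⁻¹ := by
        refine contragredient_eq ?_
        have : (genG hζ).1.transpose = (genG hζ).1 := by
          have := genG_pow_apply hζ 1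
          rw [pow_one] at this
          rw [this, Matrix.diagonal_transpose]
        rw [this]
        exact congrArg Subtype.val (mul_inv_cancel (genG hζ))
      rw [this]
      exact inv_mem (genG_mem hζ)
    · rw [contragredient_eq (N := genH)]
      · exact genH_mem hζ
      · ext1 i j
        change (matH.transpose * matH) i j = _
        fin_cases i <;> fin_cases j <;> simp [matH, Matrix.mul_apply, Fin.sum_univ_three]
    · rw [contragredient_eq (N := genI hζ)]
      · exact genI_mem hζ
      · have : (genI hζ).1.transpose = (genI hζ).1 := by
          ext1 i j
          change matI ζ j i = matI ζ i j
          rw [matI_eq hζ]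
          fin_cases i <;> fin_cases j <;> rfl
        rw [this]
        exact congrArg Subtype.val (genI_sq hζ)
  exact h hM

lemma gradientMap_mk {v : Fin 3 → ℂ} (hv : v ≠ 0) :
    gradientMap (Projectivization.mk ℂ v hv) =
      Projectivization.mk ℂ (gradVec v) (gradVec_ne_zero hv) := rfl

lemma gradVec_smul_group {hζ : IsPrimitiveRoot ζ 7} {M : Matrix.SpecialLinearGroup (Fin 3) ℂ}
    (hM : M ∈ group hζ) (v : Fin 3 → ℂ) : gradVec (M • v) = contragredient M • gradVec v := by
  rw [← transpose_mulVec_gradVec (subst_Phi4 hM) v]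
  change _ = contragredient M • M.transpose • gradVec (M • v)
  rw [smul_smul, mul_eq_one_comm.1 (transpose_mul_contragredient M), one_smul]

/-- The gradient map intertwines the action of the Klein group with its contragredient. -/
lemma gradientMap_smul {hζ : IsPrimitiveRoot ζ 7} {M : Matrix.SpecialLinearGroup (Fin 3) ℂ}
    (hM : M ∈ group hζ) (p : P2) : gradientMap (M • p) = contragredient M • gradientMap p := by
  induction p using Projectivization.ind with
  | h v hv =>
    rw [Projectivization.smul_mk, gradientMap_mk, gradientMap_mk, Projectivization.smul_mk]
    congr 1
    exact gradVec_smul_group hM v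

/-! ### The fibre of the gradient map over `[1 : 1 : 1]` -/

/-- The point `[1 : 1 : 1]`. -/
def pointP : P2 := Projectivization.mk ℂ ![1, 1, 1] (by simp)

/-- The vector `r (1, 1, 1) + s (1, ω, ω²) + t (1, ω², ω)`, in coordinates that diagonalise the
cyclic permutation of the variables. -/
def fourier (ω r s t : ℂ) : Fin 3 → ℂ :=
  ![r + s + t, r + ω * s + ω ^ 2 * t, r + ω ^ 2 * s + ω * t]

variable {ω : ℂ}

lemma cube_root_relation (hω : IsPrimitiveRoot ω 3) : ω ^ 2 + ω + 1 = 0 := by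
  have := hω.geom_sum_eq_zero (by norm_num)
  simp [Finset.sum_range_succ] at this
  linear_combination this

lemma smul_fourier (c r s t : ℂ) : c • fourier ω r s t = fourier ω (c * r) (c * s) (c * t) := by
  funext i
  fin_cases i <;> simp [fourier] <;> ring

lemma fourier_inj (h : ω ^ 2 + ω + 1 = 0) {r s t r' s' t' : ℂ} :
    fourier ω r s t = fourier ω r' s' t' ↔ r = r' ∧ s = s' ∧ t = t' := by
  refine ⟨fun h' => ?_, fun ⟨hr, hs, ht⟩ => by rw [hr, hs, ht]⟩
  have h0 : r + s + t = r' + s' + t' := congrFun h' 0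
  have h1 : r + ω * s + ω ^ 2 * t = r' + ω * s' + ω ^ 2 * t' := congrFun h' 1
  have h2 : r + ω ^ 2 * s + ω * t = r' + ω ^ 2 * s' + ω * t' := congrFun h' 2
  grind

lemma exists_eq_fourier (h : ω ^ 2 + ω + 1 = 0) (v : Fin 3 → ℂ) :
    ∃ r s t, v = fourier ω r s t := by
  refine ⟨(v 0 + v 1 + v 2) / 3, (v 0 + ω ^ 2 * v 1 + ω * v 2) / 3,
    (v 0 + ω * v 1 + ω ^ 2 * v 2) / 3, ?_⟩
  funext i
  fin_cases i <;> simp [fourier] <;> grind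

lemma fourier_ne_zero (h : ω ^ 2 + ω + 1 = 0) {r s t : ℂ} (h0 : ¬(r = 0 ∧ s = 0 ∧ t = 0)) :
    fourier ω r s t ≠ 0 := fun h' => h0 <| (fourier_inj h).1 <| h'.trans <| by
  funext i
  fin_cases i <;> simp [fourier]

lemma mk_fourier_eq_iff (h : ω ^ 2 + ω + 1 = 0) {r s t r' s' t' : ℂ}
    (h0 : fourier ω r s t ≠ 0) (h0' : fourier ω r' s' t' ≠ 0) :
    Projectivization.mk ℂ _ h0 = Projectivization.mk ℂ _ h0' ↔
      ∃ c, c * r' = r ∧ c * s' = s ∧ c * t' = t := by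
  simp_rw [Projectivization.mk_eq_mk_iff', smul_fourier, fourier_inj h]

/-- In the coordinates `r`, `s`, `t`, the fibre over `[1 : 1 : 1]` is cut out by the derivatives of
`Phi4 = 3 (r⁴ + 3r²st + (1 + 3ω) rs³ + (1 + 3ω²) rt³ - 3s²t²)` with respect to `s` and `t`. -/
lemma gradientMap_fourier_eq_iff (h : ω ^ 2 + ω + 1 = 0) {r s t : ℂ}
    (h0 : fourier ω r s t ≠ 0) :
    gradientMap (Projectivization.mk ℂ _ h0) = pointP ↔
      r ^ 2 * t + (1 + 3 * ω) * r * s ^ 2 = 2 * s * t ^ 2 ∧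
      r ^ 2 * s + (1 + 3 * ω ^ 2) * r * t ^ 2 = 2 * s ^ 2 * t := by
  rw [gradientMap_mk, pointP, Projectivization.mk_eq_mk_iff']
  have e : (∃ a : ℂ, a • ![1, 1, 1] = gradVec (fourier ω r s t)) ↔
      gradVec (fourier ω r s t) 1 = gradVec (fourier ω r s t) 0 ∧
      gradVec (fourier ω r s t) 2 = gradVec (fourier ω r s t) 0 := by
    refine ⟨fun ⟨a, ha⟩ => by simp [← ha], fun ⟨h1, h2⟩ => ⟨gradVec (fourier ω r s t) 0, ?_⟩⟩
    funext i
    fin_cases i <;> simp [h1, h2]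
  rw [e, gradVec_eq]
  simp only [fourier, Matrix.cons_val]
  constructor
  · rintro ⟨h1, h2⟩
    constructor <;> grind
  · rintro ⟨h1, h2⟩
    constructor <;> grind

/-- A point of the fibre over `[1 : 1 : 1]`, when `u` is a cube root of `7 (1 + 3ω²)` and `e` is a
root of `14e² = 7e + 1`. -/
def fibreVec (ω u e : ℂ) : Fin 3 → ℂ := fourier ω 1 (e * u) (e * ((1 + 3 * ω) * u ^ 2 / 7))

lemma fibreVec_ne_zero (h : ω ^ 2 + ω + 1 = 0) (u e : ℂ) : fibreVec ω u e ≠ 0 :=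
  fourier_ne_zero h (by simp)

/-- The point `[ω² : ω : 1]`. -/
def pointQ (ω : ℂ) : P2 := Projectivization.mk ℂ ![ω ^ 2, ω, 1] (by simp)

/-- The point `[ω : ω² : 1]`. -/
def pointQ' (ω : ℂ) : P2 := Projectivization.mk ℂ ![ω, ω ^ 2, 1] (by simp)

/-- The points of the fibre over `[1 : 1 : 1]` attached to the root `e` of `14e² = 7e + 1`. -/
def fibrePart (h : ω ^ 2 + ω + 1 = 0) (e : ℂ) : Set P2 :=
  (fun u => Projectivization.mk ℂ (fibreVec ω u e) (fibreVec_ne_zero h u e)) ''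
    {u | u ^ 3 = 7 * (1 + 3 * ω ^ 2)}

lemma fourier_pointP : fourier ω 1 0 0 = ![1, 1, 1] := by
  simp [fourier]

lemma fourier_pointQ (h : ω ^ 2 + ω + 1 = 0) : fourier ω 0 0 (ω ^ 2) = ![ω ^ 2, ω, 1] := by
  funext i
  fin_cases i <;> simp [fourier] <;> grind

lemma fourier_pointQ' (h : ω ^ 2 + ω + 1 = 0) : fourier ω 0 ω 0 = ![ω, ω ^ 2, 1] := by
  funext i
  fin_cases i <;> simp [fourier] <;> grind

lemma gradientMap_pointP : gradientMap pointP = pointP := by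
  rw [pointP, gradientMap_mk, Projectivization.mk_eq_mk_iff']
  refine ⟨4, ?_⟩
  funext i
  fin_cases i <;> simp [gradVec_eq] <;> norm_num

lemma gradientMap_pointQ (h : ω ^ 2 + ω + 1 = 0) : gradientMap (pointQ ω) = pointP := by
  unfold pointQ
  simp_rw [← fourier_pointQ h]
  rw [gradientMap_fourier_eq_iff h]
  simp

lemma gradientMap_pointQ' (h : ω ^ 2 + ω + 1 = 0) : gradientMap (pointQ' ω) = pointP := by
  unfold pointQ'
  simp_rw [← fourier_pointQ' h]
  rw [gradientMap_fourier_eq_iff h]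
  simp

lemma gradientMap_of_mem_fibrePart {h : ω ^ 2 + ω + 1 = 0} {e : ℂ} (he : 14 * e ^ 2 = 7 * e + 1)
    {p : P2} (hp : p ∈ fibrePart h e) : gradientMap p = pointP := by
  obtain ⟨u, hu, rfl⟩ := hp
  have hu : u ^ 3 = 7 * (1 + 3 * ω ^ 2) := hu
  have hw : (1 + 3 * ω) * (1 + 3 * ω ^ 2) = 7 := by grind
  refine (gradientMap_fourier_eq_iff h _).2 ⟨?_, ?_⟩
  · grind
  · grind

/-- The fibre over `[1 : 1 : 1]`; `e` and `e'` are the two roots of `14e² = 7e + 1`. -/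
lemma mem_fibre_iff (h : ω ^ 2 + ω + 1 = 0) {e e' : ℂ} (he : 14 * e ^ 2 = 7 * e + 1)
    (hee : e + e' = 1 / 2) (p : P2) : gradientMap p = pointP ↔
      p = pointP ∨ (p = pointQ ω ∨ p = pointQ' ω) ∨ p ∈ fibrePart h e ∨ p ∈ fibrePart h e' := by
  have he' : 14 * e' ^ 2 = 7 * e' + 1 := by grind
  constructor
  swap
  · rintro (rfl | (rfl | rfl) | hp | hp)
    exacts [gradientMap_pointP, gradientMap_pointQ h, gradientMap_pointQ' h,
      gradientMap_of_mem_fibrePart he hp, gradientMap_of_mem_fibrePart he' hp]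
  intro hp
  induction p using Projectivization.ind with
  | h v hv =>
    obtain ⟨r, s, t, rfl⟩ := exists_eq_fourier h v
    obtain ⟨h1, h2⟩ := (gradientMap_fourier_eq_iff h hv).1 hp
    have hω0 : ω ≠ 0 := by grind
    by_cases hr : r = 0
    · right; left
      have hst : s * t = 0 := by
        have : (s * t) ^ 2 = 0 := by grind
        simpa using this
      have h0 : ¬(s = 0 ∧ t = 0) := by
        rintro ⟨rfl, rfl⟩
        apply hv
        funext i
        fin_cases i <;> simp [fourier, hr]
      unfold pointQ pointQ'
      simp_rw [← fourier_pointQ h, ← fourier_pointQ' h]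
      rw [mk_fourier_eq_iff h, mk_fourier_eq_iff h]
      rcases mul_eq_zero.1 hst with rfl | rfl
      · left
        exact ⟨t / ω ^ 2, by simp [hr], by simp, by field_simp⟩
      · right
        exact ⟨s / ω, by simp [hr], by field_simp, by simp⟩
    · by_cases hs : s = 0
      · have ht : t = 0 := by
          have : r ^ 2 * t = 0 := by grind
          simpa [hr] using this
        left
        unfold pointP
        simp_rw [← fourier_pointP (ω := ω)]
        rw [mk_fourier_eq_iff h]
        exact ⟨r, by simp, by simp [hs], by simp [ht]⟩
      · right; right
        have hg : (1 + 3 * ω) * (1 + 3 * ω ^ 2) = 7 := by grind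
        have ht : t ≠ 0 := by
          rintro rfl
          have : r ^ 2 * s = 0 := by grind
          simp [hr, hs] at this
        have hg0 : 1 + 3 * ω ≠ 0 := by grind
        have hg0' : 1 + 3 * ω ^ 2 ≠ 0 := by grind
        have hst : (1 + 3 * ω) * s ^ 3 = (1 + 3 * ω ^ 2) * t ^ 3 := by
          have : r * ((1 + 3 * ω) * s ^ 3) = r * ((1 + 3 * ω ^ 2) * t ^ 3) := by
            linear_combination s * h1 - t * h2
          exact mul_left_cancel₀ hr this
        -- The ratios `t / s` and `s / r` determine `u` and the root of the quadratic equation.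
        obtain ⟨u, hu⟩ : ∃ u, u * s = (1 + 3 * ω ^ 2) * t :=
          ⟨(1 + 3 * ω ^ 2) * t / s, by field_simp⟩
        have hu0 : u ≠ 0 := by
          rintro rfl
          simp [hg0', ht] at hu
        have hu3 : u ^ 3 = 7 * (1 + 3 * ω ^ 2) := by
          have : s ^ 3 * u ^ 3 = s ^ 3 * (7 * (1 + 3 * ω ^ 2)) := by
            have : (u * s) ^ 3 = ((1 + 3 * ω ^ 2) * t) ^ 3 := by rw [hu]
            linear_combination this - (1 + 3 * ω ^ 2) ^ 2 * hst + (1 + 3 * ω ^ 2) * s ^ 3 * hg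
          exact mul_left_cancel₀ (pow_ne_zero 3 hs) this
        obtain ⟨f, hf⟩ : ∃ f, s = r * (f * u) := ⟨s / (r * u), by field_simp⟩
        have hf0 : f ≠ 0 := by
          rintro rfl
          simp [hs] at hf
        have hft : t = r * (f * ((1 + 3 * ω) * u ^ 2 / 7)) := by
          linear_combination (-1 / 7 : ℂ) * t * hg - (1 + 3 * ω) / 7 * hu
            + (1 + 3 * ω) * u / 7 * hf
        have hquad : 14 * f ^ 2 = 7 * f + 1 := by
          have : r ^ 3 * f * u ^ 2 * (14 * f ^ 2) = r ^ 3 * f * u ^ 2 * (7 * f + 1) := by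
            rw [hf, hft] at h1
            linear_combination (-(1 + 3 * ω ^ 2)) * h1
              - 2 / 49 * (1 + 3 * ω ^ 2) * (1 + 3 * ω) ^ 2 * r ^ 3 * f ^ 3 * u ^ 2 * hu3
              + (r ^ 3 * f * u ^ 2 * (1 / 7 + f) - 2 / 7 * r ^ 3 * f ^ 3 * u ^ 2
                * ((1 + 3 * ω) * (1 + 3 * ω ^ 2) + 7)) * hg
          exact mul_left_cancel₀ (by positivity) this
        have hef : f = e ∨ f = e' := by
          have : (f - e) * (f - e') = 0 := by grind
          simpa [sub_eq_zero] using this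
        have hmem : Projectivization.mk ℂ _ hv ∈ fibrePart h f :=
          ⟨u, hu3, ((mk_fourier_eq_iff h _ _).2 ⟨r, by simp, hf.symm, hft.symm⟩).symm⟩
        rcases hef with rfl | rfl
        exacts [Or.inl hmem, Or.inr hmem]

/-! ### Separation of the orbits by the invariants of degrees 4 and 6 -/

/-- On `fibreVec ω u e` the coordinates are `s = eu` and `t = ew` with `uw = 7`, `w³ = 7 (1 + 3ω)`,
so the invariants do not depend on the cube root `u`. -/
lemma eval_Phi4_fibreVec (h : ω ^ 2 + ω + 1 = 0) {u e : ℂ} (he : 14 * e ^ 2 = 7 * e + 1)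
    (hu : u ^ 3 = 7 * (1 + 3 * ω ^ 2)) :
    eval (fibreVec ω u e) Phi4 = 63 * (1 + 5 * e) / 8 := by
  obtain ⟨w, hw⟩ : ∃ w, w = (1 + 3 * ω) * u ^ 2 / 7 := ⟨_, rfl⟩
  have h1 : u * w = 7 := by grind
  have h2 : w ^ 3 = 7 * (1 + 3 * ω) := by grind
  simp [fibreVec, Phi4, fourier, ← hw]
  clear hw
  have : 3 * (1 + 3 * e ^ 2 * (u * w) + (1 + 3 * ω) * e ^ 3 * u ^ 3
    + (1 + 3 * ω ^ 2) * e ^ 3 * w ^ 3 - 3 * e ^ 4 * (u * w) ^ 2) = 63 * (1 + 5 * e) / 8 := by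
    rw [h1, h2, hu]
    grind
  rw [← this]
  grind

lemma eval_Phi6_fibreVec (h : ω ^ 2 + ω + 1 = 0) {u e : ℂ} (he : 14 * e ^ 2 = 7 * e + 1)
    (hu : u ^ 3 = 7 * (1 + 3 * ω ^ 2)) :
    eval (fibreVec ω u e) Phi6 = -189 * (23 + 203 * e) / 16 := by
  obtain ⟨w, hw⟩ : ∃ w, w = (1 + 3 * ω) * u ^ 2 / 7 := ⟨_, rfl⟩
  have h1 : u * w = 7 := by grind
  have h2 : w ^ 3 = 7 * (1 + 3 * ω) := by grind
  rw [Phi6_eq]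
  simp [fibreVec, fourier, ← hw]
  clear hw
  grind

lemma eval_Phi4_pointP : eval ![1, 1, 1] Phi4 = 3 := by
  simp [Phi4]
  norm_num

lemma eval_Phi6_pointP : eval ![1, 1, 1] Phi6 = -2 := by
  simp [Phi6_eq]
  norm_num

lemma eval_Phi4_pointQ (h : ω ^ 2 + ω + 1 = 0) : eval ![ω ^ 2, ω, 1] Phi4 = 0 := by
  simp [Phi4]
  grind

lemma eval_Phi6_pointQ (h : ω ^ 2 + ω + 1 = 0) : eval ![ω ^ 2, ω, 1] Phi6 = 3 * ω - 5 := by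
  simp [Phi6_eq]
  grind

/-! ### The orbit of 28 points -/

lemma mk_eq_mk_of_minors {v w : Fin 3 → ℂ} (hv : v ≠ 0) (hw : w ≠ 0)
    (h01 : v 0 * w 1 = v 1 * w 0) (h02 : v 0 * w 2 = v 2 * w 0) (h12 : v 1 * w 2 = v 2 * w 1) :
    Projectivization.mk ℂ v hv = Projectivization.mk ℂ w hw := by
  have h : ∀ i j, v i * w j = v j * w i := by
    intro i j
    fin_cases i <;> fin_cases j <;> first | rfl | assumption | exact Eq.symm (by assumption)
  obtain ⟨k, hk⟩ := Function.ne_iff.1 hw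
  rw [Projectivization.mk_eq_mk_iff']
  refine ⟨v k / w k, funext fun i => ?_⟩
  rw [Pi.smul_apply, smul_eq_mul, div_mul_eq_mul_div, div_eq_iff hk, h]

lemma minors_of_mk_eq_mk {v w : Fin 3 → ℂ} {hv : v ≠ 0} {hw : w ≠ 0}
    (h : Projectivization.mk ℂ v hv = Projectivization.mk ℂ w hw) (i j : Fin 3) :
    v i * w j = v j * w i := by
  obtain ⟨a, rfl⟩ := (Projectivization.mk_eq_mk_iff' ℂ v w hv hw).1 h
  simp
  ring

/-- A vector with entries in `ℚ(ζ + ζ⁻¹)` whose orbit under the subgroup of order 21 generated by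
`genG` and `genH` is the part of the orbit of `[1 : 1 : 1]` off the orbit of the diagonal group. -/
def vecR (ζ : ℂ) : Fin 3 → ℂ :=
  ![1, 3 + 2 * (ζ ^ 2 + ζ ^ 5) + (ζ ^ 3 + ζ ^ 4), 2 + (ζ ^ 2 + ζ ^ 5)]

lemma vecR_ne_zero (ζ : ℂ) : vecR ζ ≠ 0 := fun h => one_ne_zero (congrFun h 0)

/-- The point with coordinates `vecR`. -/
def pointR (ζ : ℂ) : P2 := Projectivization.mk ℂ (vecR ζ) (vecR_ne_zero ζ)

lemma genH_smul_vec (v : Fin 3 → ℂ) : genH • v = ![v 1, v 2, v 0] := by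
  change matH.mulVec v = _
  funext i
  fin_cases i <;> simp [matH, dotProduct, Fin.sum_univ_three]

lemma genG_pow_smul_vec (hζ : IsPrimitiveRoot ζ 7) (n : ℕ) (v : Fin 3 → ℂ) :
    genG hζ ^ n • v = ![ζ ^ (4 * n) * v 0, ζ ^ (2 * n) * v 1, ζ ^ n * v 2] := by
  change (genG hζ ^ n).1.mulVec v = _
  rw [genG_pow_apply]
  funext i
  fin_cases i <;> simp [Matrix.mulVec_diagonal]

lemma genI_smul_vec (hζ : IsPrimitiveRoot ζ 7) (v : Fin 3 → ℂ) : genI hζ • v =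
    ![alpha ζ * v 0 + beta ζ * v 1 + gamma ζ * v 2, beta ζ * v 0 + gamma ζ * v 1 + alpha ζ * v 2,
      gamma ζ * v 0 + alpha ζ * v 1 + beta ζ * v 2] := by
  change (matI ζ).mulVec v = _
  rw [matI_eq hζ]
  funext i
  fin_cases i <;> simp [dotProduct, Fin.sum_univ_three]

lemma genH_smul_pointP : genH • pointP = pointP := by
  rw [pointP, Projectivization.smul_mk]
  simp_rw [genH_smul_vec]
  simp

lemma genI_smul_pointP (hζ : IsPrimitiveRoot ζ 7) : genI hζ • pointP = pointP := by
  rw [pointP, Projectivization.smul_mk]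
  apply mk_eq_mk_of_minors <;> rw [genI_smul_vec] <;> simp <;> ring

lemma beta_eq (hζ : IsPrimitiveRoot ζ 7) :
    beta ζ = (-2 - ζ ^ 2 + 2 * ζ ^ 3 + 2 * ζ ^ 4 - ζ ^ 5) / 7 := by
  have h := cyclotomic_relation hζ
  unfold beta alpha
  grind

lemma gamma_eq (hζ : IsPrimitiveRoot ζ 7) :
    gamma ζ = (-4 - 2 * ζ ^ 2 - 3 * ζ ^ 3 - 3 * ζ ^ 4 - 2 * ζ ^ 5) / 7 := by
  have h := cyclotomic_relation hζ
  unfold gamma alpha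
  grind

/-- This and the six lemmas that follow determine how `genI` permutes the orbit of `[1 : 1 : 1]`, as
`genI` conjugates `genH` to its inverse and `genH` normalises the diagonal group. -/
lemma genI_smul_genG_smul_pointP (hζ : IsPrimitiveRoot ζ 7) :
    genI hζ • genG hζ ^ 1 • pointP = genG hζ ^ 3 • pointR ζ := by
  have h := cyclotomic_relation hζ
  rw [pointP, pointR]
  simp only [Projectivization.smul_mk]
  apply mk_eq_mk_of_minors <;>
  · simp only [genI_smul_vec, genG_pow_smul_vec, beta_eq hζ, gamma_eq hζ]
    simp [vecR, alpha]
    grind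

lemma genI_smul_genG_pow_six_smul_pointP (hζ : IsPrimitiveRoot ζ 7) :
    genI hζ • genG hζ ^ 6 • pointP = genG hζ ^ 4 • pointR ζ := by
  have h := cyclotomic_relation hζ
  rw [pointP, pointR]
  simp only [Projectivization.smul_mk]
  apply mk_eq_mk_of_minors <;>
  · simp only [genI_smul_vec, genG_pow_smul_vec, beta_eq hζ, gamma_eq hζ]
    simp [vecR, alpha]
    grind

lemma genI_smul_pointR (hζ : IsPrimitiveRoot ζ 7) :
    genI hζ • pointR ζ = genH • pointR ζ := by
  have h := cyclotomic_relation hζ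
  rw [pointR]
  simp only [Projectivization.smul_mk]
  apply mk_eq_mk_of_minors <;>
  · simp only [genI_smul_vec, genH_smul_vec, beta_eq hζ, gamma_eq hζ]
    simp [vecR, alpha]
    grind

lemma genI_smul_genG_smul_pointR (hζ : IsPrimitiveRoot ζ 7) :
    genI hζ • genG hζ ^ 1 • pointR ζ = genG hζ ^ 1 • pointR ζ := by
  have h := cyclotomic_relation hζ
  rw [pointR]
  simp only [Projectivization.smul_mk]
  apply mk_eq_mk_of_minors <;>
  · simp only [genI_smul_vec, genG_pow_smul_vec, beta_eq hζ, gamma_eq hζ]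
    simp [vecR, alpha]
    grind

lemma genI_smul_genG_pow_two_smul_pointR (hζ : IsPrimitiveRoot ζ 7) :
    genI hζ • genG hζ ^ 2 • pointR ζ = genH • genG hζ ^ 5 • pointR ζ := by
  have h := cyclotomic_relation hζ
  rw [pointR]
  simp only [Projectivization.smul_mk]
  apply mk_eq_mk_of_minors <;>
  · simp only [genI_smul_vec, genH_smul_vec, genG_pow_smul_vec, beta_eq hζ, gamma_eq hζ]
    simp [vecR, alpha]
    grind

lemma genI_smul_genG_pow_five_smul_pointR (hζ : IsPrimitiveRoot ζ 7) :
    genI hζ • genG hζ ^ 5 • pointR ζ = genH • genG hζ ^ 2 • pointR ζ := by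
  have h := cyclotomic_relation hζ
  rw [pointR]
  simp only [Projectivization.smul_mk]
  apply mk_eq_mk_of_minors <;>
  · simp only [genI_smul_vec, genH_smul_vec, genG_pow_smul_vec, beta_eq hζ, gamma_eq hζ]
    simp [vecR, alpha]
    grind

lemma genI_smul_genG_pow_six_smul_pointR (hζ : IsPrimitiveRoot ζ 7) :
    genI hζ • genG hζ ^ 6 • pointR ζ = genG hζ ^ 6 • pointR ζ := by
  have h := cyclotomic_relation hζ
  rw [pointR]
  simp only [Projectivization.smul_mk]
  apply mk_eq_mk_of_minors <;>
  · simp only [genI_smul_vec, genG_pow_smul_vec, beta_eq hζ, gamma_eq hζ]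
    simp [vecR, alpha]
    grind

lemma genI_smul_genI_smul (hζ : IsPrimitiveRoot ζ 7) (p : P2) : genI hζ • genI hζ • p = p := by
  rw [smul_smul, genI_sq, one_smul]

lemma genG_pow_mul_genH (hζ : IsPrimitiveRoot ζ 7) (m : ℕ) :
    genG hζ ^ m * genH = genH * genG hζ ^ (2 * m) := by
  rw [pow_mul]
  exact ((SemiconjBy.pow_right (genG_mul_genH hζ).symm m)).symm

lemma genH_mul_genG_pow (hζ : IsPrimitiveRoot ζ 7) (m : ℕ) :
    genH * genG hζ ^ m = genG hζ ^ (4 * m) * genH := by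
  rw [genG_pow_mul_genH, show 2 * (4 * m) = 7 * m + m by ring, pow_add, pow_mul, genG_pow,
    one_pow, one_mul]

lemma genI_mul_genH_pow (hζ : IsPrimitiveRoot ζ 7) (l : ℕ) :
    genI hζ * genH ^ l = genH ^ (2 * l) * genI hζ := by
  rw [pow_mul]
  exact (SemiconjBy.pow_right (genI_mul_genH hζ) l)

lemma genG_pow_mod (hζ : IsPrimitiveRoot ζ 7) (m : ℕ) : genG hζ ^ (m % 7) = genG hζ ^ m := by
  conv_rhs => rw [← Nat.mod_add_div m 7, pow_add, pow_mul, genG_pow, one_pow, mul_one]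

lemma genH_pow_mod (l : ℕ) : genH ^ (l % 3) = genH ^ l := by
  conv_rhs => rw [← Nat.mod_add_div l 3, pow_add, pow_mul, genH_pow, one_pow, mul_one]

/-- The orbit of `[1 : 1 : 1]` under the diagonal group of order 7. -/
def diagonalPart (hζ : IsPrimitiveRoot ζ 7) : Set P2 := {p | ∃ m : ℕ, p = genG hζ ^ m • pointP}

/-- The orbit of `pointR` under the group of order 21 generated by `genG` and `genH`. -/
def mainPart (hζ : IsPrimitiveRoot ζ 7) : Set P2 :=
  {p | ∃ l m : ℕ, p = genH ^ l • genG hζ ^ m • pointR ζ}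

lemma genG_smul_mem_diagonalPart {hζ : IsPrimitiveRoot ζ 7} {p : P2} (hp : p ∈ diagonalPart hζ) :
    genG hζ • p ∈ diagonalPart hζ := by
  obtain ⟨m, rfl⟩ := hp
  exact ⟨m + 1, by rw [smul_smul, pow_succ']⟩

lemma genH_smul_mem_diagonalPart {hζ : IsPrimitiveRoot ζ 7} {p : P2} (hp : p ∈ diagonalPart hζ) :
    genH • p ∈ diagonalPart hζ := by
  obtain ⟨m, rfl⟩ := hp
  exact ⟨4 * m, by rw [smul_smul, genH_mul_genG_pow, mul_smul, genH_smul_pointP]⟩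

lemma genG_smul_mem_mainPart {hζ : IsPrimitiveRoot ζ 7} {p : P2} (hp : p ∈ mainPart hζ) :
    genG hζ • p ∈ mainPart hζ := by
  obtain ⟨l, m, rfl⟩ := hp
  have h : ∀ k, genG hζ ^ k * genH ^ l = genH ^ l * genG hζ ^ (2 ^ l * k) := by
    induction l with
    | zero => simp
    | succ l ih =>
      intro k
      rw [pow_succ, ← mul_assoc, ih, mul_assoc, genG_pow_mul_genH, mul_assoc, pow_succ 2]
      congr 3
      ring
  refine ⟨l, 2 ^ l * 1 + m, ?_⟩
  have h1 := h 1
  rw [pow_one] at h1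
  rw [smul_smul, h1, mul_smul, smul_smul (genG hζ ^ _), ← pow_add]

lemma genH_pow_smul_mem_mainPart {hζ : IsPrimitiveRoot ζ 7} {p : P2} (k : ℕ)
    (hp : p ∈ mainPart hζ) : genH ^ k • p ∈ mainPart hζ := by
  obtain ⟨l, m, rfl⟩ := hp
  exact ⟨k + l, m, by rw [smul_smul (genH ^ k), pow_add]⟩

lemma genG_pow_smul_pointR_mem (hζ : IsPrimitiveRoot ζ 7) (m : ℕ) :
    genG hζ ^ m • pointR ζ ∈ mainPart hζ := ⟨0, m, by simp⟩

lemma genI_smul_genG_pow_smul_pointR_mem (hζ : IsPrimitiveRoot ζ 7) (m : ℕ) :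
    genI hζ • genG hζ ^ m • pointR ζ ∈ diagonalPart hζ ∪ mainPart hζ := by
  rw [← genG_pow_mod]
  have hm : m % 7 < 7 := Nat.mod_lt _ (by norm_num)
  interval_cases m % 7
  · rw [pow_zero, one_smul, genI_smul_pointR]
    exact Or.inr ⟨1, 0, by simp⟩
  · rw [genI_smul_genG_smul_pointR]
    exact Or.inr (genG_pow_smul_pointR_mem hζ _)
  · rw [genI_smul_genG_pow_two_smul_pointR]
    exact Or.inr ⟨1, 5, by rw [pow_one]⟩
  · rw [← genI_smul_genG_smul_pointP, genI_smul_genI_smul]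
    exact Or.inl ⟨1, rfl⟩
  · rw [← genI_smul_genG_pow_six_smul_pointP, genI_smul_genI_smul]
    exact Or.inl ⟨6, rfl⟩
  · rw [genI_smul_genG_pow_five_smul_pointR]
    exact Or.inr ⟨1, 2, by rw [pow_one]⟩
  · rw [genI_smul_genG_pow_six_smul_pointR]
    exact Or.inr (genG_pow_smul_pointR_mem hζ _)

lemma genI_smul_genG_pow_smul_pointP_mem (hζ : IsPrimitiveRoot ζ 7) (m : ℕ) :
    genI hζ • genG hζ ^ m • pointP ∈ diagonalPart hζ ∪ mainPart hζ := by
  -- Conjugation by `genH` multiplies the exponent by 4 modulo 7.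
  have key : ∀ k, genI hζ • genG hζ ^ k • pointP ∈ mainPart hζ →
      genI hζ • genG hζ ^ (4 * k) • pointP ∈ mainPart hζ := by
    intro k hk
    have : genG hζ ^ (4 * k) • pointP = genH • genG hζ ^ k • pointP := by
      rw [smul_smul genH, genH_mul_genG_pow, mul_smul, genH_smul_pointP]
    rw [this, smul_smul (genI hζ), genI_mul_genH, mul_smul]
    exact genH_pow_smul_mem_mainPart 2 hk
  have h1 : genI hζ • genG hζ ^ 1 • pointP ∈ mainPart hζ := by
    rw [genI_smul_genG_smul_pointP]
    exact genG_pow_smul_pointR_mem hζ _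
  have h6 : genI hζ • genG hζ ^ 6 • pointP ∈ mainPart hζ := by
    rw [genI_smul_genG_pow_six_smul_pointP]
    exact genG_pow_smul_pointR_mem hζ _
  have h4 := key _ h1
  have h2 := key _ h4
  have h3 := key _ h6
  have h5 := key _ h3
  rw [← genG_pow_mod] at h2 h3 h4 h5 ⊢
  have hm : m % 7 < 7 := Nat.mod_lt _ (by norm_num)
  interval_cases m % 7
  · rw [pow_zero, one_smul, genI_smul_pointP]
    exact Or.inl ⟨0, by simp⟩
  exacts [Or.inr h1, Or.inr h2, Or.inr h3, Or.inr h4, Or.inr h5, Or.inr h6]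

lemma genI_smul_mem {hζ : IsPrimitiveRoot ζ 7} {p : P2}
    (hp : p ∈ diagonalPart hζ ∪ mainPart hζ) : genI hζ • p ∈ diagonalPart hζ ∪ mainPart hζ := by
  rcases hp with ⟨m, rfl⟩ | ⟨l, m, rfl⟩
  · exact genI_smul_genG_pow_smul_pointP_mem hζ m
  · rw [smul_smul (genI hζ), genI_mul_genH_pow, mul_smul]
    generalize 2 * l = k
    rcases genI_smul_genG_pow_smul_pointR_mem hζ m with h | h
    · left
      induction k with
      | zero => simpa using h
      | succ k ih =>
        rw [pow_succ', mul_smul]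
        exact genH_smul_mem_diagonalPart ih
    · exact Or.inr (genH_pow_smul_mem_mainPart k h)

lemma mem_orbit_iff {hζ : IsPrimitiveRoot ζ 7} {p q : P2} :
    q ∈ orbit hζ p ↔ ∃ M ∈ group hζ, M • p = q :=
  ⟨fun ⟨⟨M, hM⟩, h⟩ => ⟨M, hM, h⟩, fun ⟨M, hM, h⟩ => ⟨⟨M, hM⟩, h⟩⟩

lemma diagonalPart_eq (hζ : IsPrimitiveRoot ζ 7) : diagonalPart hζ =
    (fun m : ℕ => genG hζ ^ m • pointP) '' (Finset.range 7 : Set ℕ) := by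
  ext p
  simp only [diagonalPart, Set.mem_ofPred_eq, Set.mem_image, Finset.coe_range, Set.mem_Iio]
  constructor
  · rintro ⟨m, rfl⟩
    exact ⟨m % 7, Nat.mod_lt _ (by norm_num), by rw [genG_pow_mod]⟩
  · rintro ⟨m, -, rfl⟩
    exact ⟨m, rfl⟩

lemma mainPart_eq (hζ : IsPrimitiveRoot ζ 7) : mainPart hζ =
    (fun x : ℕ × ℕ => genH ^ x.1 • genG hζ ^ x.2 • pointR ζ) ''
      (Finset.range 3 ×ˢ Finset.range 7 : Finset (ℕ × ℕ)) := by
  ext p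
  simp only [mainPart, Set.mem_ofPred_eq, Set.mem_image, Finset.coe_product, Finset.coe_range,
    Set.mem_prod, Set.mem_Iio, Prod.exists]
  constructor
  · rintro ⟨l, m, rfl⟩
    exact ⟨l % 3, m % 7, ⟨Nat.mod_lt _ (by norm_num), Nat.mod_lt _ (by norm_num)⟩,
      by rw [genG_pow_mod, genH_pow_mod]⟩
  · rintro ⟨l, m, -, rfl⟩
    exact ⟨l, m, rfl⟩

open scoped Pointwise in
lemma O28_eq (hζ : IsPrimitiveRoot ζ 7) : O28 hζ = diagonalPart hζ ∪ mainPart hζ := by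
  have hfin : (diagonalPart hζ ∪ mainPart hζ).Finite := by
    rw [diagonalPart_eq, mainPart_eq]
    exact (Finset.finite_toSet _).image _ |>.union ((Finset.finite_toSet _).image _)
  apply Set.Subset.antisymm
  · have hle : group hζ ≤ MulAction.stabilizer _ (diagonalPart hζ ∪ mainPart hζ) := by
      apply group_le <;> rw [MulAction.mem_stabilizer_set_iff_smul_set_subset hfin] <;>
        rintro _ ⟨p, hp, rfl⟩
      · exact hp.imp genG_smul_mem_diagonalPart genG_smul_mem_mainPart
      · refine hp.imp genH_smul_mem_diagonalPart fun h => ?_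
        simpa using genH_pow_smul_mem_mainPart 1 h
      · exact genI_smul_mem hp
    intro q hq
    obtain ⟨M, hM, rfl⟩ := mem_orbit_iff.1 hq
    exact (MulAction.mem_stabilizer_set.1 (hle hM) _).2 (Or.inl ⟨0, by simp [pointP]⟩)
  · rintro _ (⟨m, rfl⟩ | ⟨l, m, rfl⟩)
    · exact mem_orbit_iff.2 ⟨_, pow_mem (genG_mem hζ) m, rfl⟩
    · have hR : pointR ζ = (genG hζ ^ 3)⁻¹ • genI hζ • genG hζ ^ 1 • pointP := by
        rw [genI_smul_genG_smul_pointP, inv_smul_smul]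
      rw [hR]
      simp only [smul_smul]
      refine mem_orbit_iff.2 ⟨_, ?_, rfl⟩
      have hG := genG_mem hζ
      exact mul_mem (pow_mem (genH_mem hζ) l) (mul_mem (pow_mem hG m)
        (mul_mem (inv_mem (pow_mem hG 3)) (mul_mem (genI_mem hζ) (pow_mem hG 1))))

/-- The values at `v` of the monomials `x³y`, `y³z`, `z³x`, which are invariant under `genG`. -/
def torusInv (v : Fin 3 → ℂ) (i : Fin 3) : ℂ := v i ^ 3 * v (i + 1)

lemma torusInv_genG (hζ : IsPrimitiveRoot ζ 7) (m : ℕ) (v : Fin 3 → ℂ) :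
    torusInv (genG hζ ^ m • v) = torusInv v := by
  have h : (ζ ^ m) ^ 7 = 1 := by rw [← pow_mul, mul_comm, pow_mul, hζ.pow_eq_one, one_pow]
  rw [genG_pow_smul_vec, mul_comm 4, mul_comm 2, pow_mul, pow_mul]
  generalize ζ ^ m = a at h
  funext i
  fin_cases i <;> simp [torusInv] <;> grind

lemma torusInv_genH (v : Fin 3 → ℂ) (i : Fin 3) : torusInv (genH • v) i = torusInv v (i + 1) := by
  rw [genH_smul_vec]
  fin_cases i <;> rfl

lemma torusInv_of_mk_eq_mk {v w : Fin 3 → ℂ} {hv : v ≠ 0} {hw : w ≠ 0}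
    (h : Projectivization.mk ℂ v hv = Projectivization.mk ℂ w hw) (i j : Fin 3) :
    torusInv v i * torusInv w j = torusInv v j * torusInv w i := by
  obtain ⟨a, rfl⟩ := (Projectivization.mk_eq_mk_iff' ℂ v w hv hw).1 h
  simp [torusInv]
  ring

/-- The two inequalities exclude that the point with coordinates `torusInv (vecR ζ)` is fixed by a
nontrivial cyclic permutation of the coordinates. -/
lemma torusInv_pointR (hζ : IsPrimitiveRoot ζ 7) :
    torusInv (vecR ζ) 0 * torusInv (vecR ζ) 2 ≠ torusInv (vecR ζ) 1 ^ 2 ∧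
    torusInv (vecR ζ) 0 ^ 2 ≠ torusInv (vecR ζ) 1 * torusInv (vecR ζ) 2 := by
  have h := cyclotomic_relation hζ
  constructor <;> intro h' <;> simp [torusInv, vecR] at h' <;> grind

lemma genG_pow_smul_inj (hζ : IsPrimitiveRoot ζ 7) {v : Fin 3 → ℂ} (hv : v ≠ 0) (h1 : v 1 ≠ 0)
    (h2 : v 2 ≠ 0) {m m' : ℕ} (hm : m < 7) (hm' : m' < 7)
    (h : genG hζ ^ m • (Projectivization.mk ℂ v hv : P2) =
      genG hζ ^ m' • (Projectivization.mk ℂ v hv : P2)) : m = m' := by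
  simp only [Projectivization.smul_mk] at h
  have key := minors_of_mk_eq_mk h 1 2
  simp only [genG_pow_smul_vec, Matrix.cons_val] at key
  have hz : ζ ≠ 0 := hζ.ne_zero (by norm_num)
  have e : (v 1 * v 2 * (ζ ^ m * ζ ^ m')) * ζ ^ m = (v 1 * v 2 * (ζ ^ m * ζ ^ m')) * ζ ^ m' := by
    linear_combination key
  exact hζ.pow_inj hm hm' (mul_left_cancel₀ (by simp [h1, h2, hz]) e)

lemma genG_smul_pointR_ne (hζ : IsPrimitiveRoot ζ 7) (m m' : ℕ) :
    genG hζ ^ m • pointR ζ ≠ genH ^ 1 • genG hζ ^ m' • pointR ζ ∧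
    genG hζ ^ m • pointR ζ ≠ genH ^ 2 • genG hζ ^ m' • pointR ζ := by
  obtain ⟨h1, h2⟩ := torusInv_pointR hζ
  constructor <;> intro h <;> simp only [pointR, pow_one, pow_two, mul_smul,
    Projectivization.smul_mk] at h <;> have key := torusInv_of_mk_eq_mk h 0 1
  · rw [torusInv_genH, torusInv_genH, torusInv_genG, torusInv_genG] at key
    exact h1 (by rw [pow_two]; exact key)
  · rw [torusInv_genH, torusInv_genH, torusInv_genH, torusInv_genH, torusInv_genG,
      torusInv_genG] at key
    exact h2 (by rw [pow_two]; exact key)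

lemma vecR_one_two_ne_zero (hζ : IsPrimitiveRoot ζ 7) : vecR ζ 1 ≠ 0 ∧ vecR ζ 2 ≠ 0 := by
  have h := cyclotomic_relation hζ
  constructor <;> intro h' <;> simp [vecR] at h' <;> grind

lemma mainPart_injOn (hζ : IsPrimitiveRoot ζ 7) :
    Set.InjOn (fun x : ℕ × ℕ => genH ^ x.1 • genG hζ ^ x.2 • pointR ζ)
      (Finset.range 3 ×ˢ Finset.range 7 : Finset (ℕ × ℕ)) := by
  have key : ∀ l l' m m' : ℕ, l ≤ l' → l' < 3 → m < 7 → m' < 7 →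
      genH ^ l • genG hζ ^ m • pointR ζ = genH ^ l' • genG hζ ^ m' • pointR ζ →
      l = l' ∧ m = m' := by
    intro l l' m m' hl hl' hm hm' h
    obtain ⟨k, rfl⟩ := Nat.exists_eq_add_of_le hl
    rw [pow_add, mul_smul, smul_left_cancel_iff] at h
    have hk : k < 3 := by omega
    interval_cases k
    · rw [pow_zero, one_smul] at h
      exact ⟨rfl, genG_pow_smul_inj hζ _ (vecR_one_two_ne_zero hζ).1 (vecR_one_two_ne_zero hζ).2
        hm hm' h⟩
    · exact absurd h (genG_smul_pointR_ne hζ m m').1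
    · exact absurd h (genG_smul_pointR_ne hζ m m').2
  rintro ⟨l, m⟩ h ⟨l', m'⟩ h' heq
  simp only [Finset.coe_product, Finset.coe_range, Set.mem_prod, Set.mem_Iio] at h h'
  rcases le_total l l' with hl | hl
  · obtain ⟨h1, h2⟩ := key l l' m m' hl h'.1 h.2 h'.2 heq
    rw [h1, h2]
  · obtain ⟨h1, h2⟩ := key l' l m' m hl h.1 h'.2 h.2 heq.symm
    rw [h1, h2]

lemma disjoint_parts (hζ : IsPrimitiveRoot ζ 7) :
    Disjoint (diagonalPart hζ) (mainPart hζ) := by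
  rw [Set.disjoint_left]
  rintro _ ⟨m, rfl⟩ ⟨l, m', h⟩
  -- Cancelling the power of `genH` leaves a point of the diagonal orbit of `pointP`.
  have h2 : ∀ k : ℕ, genH ^ k • (genG hζ ^ m • pointP) ∈ diagonalPart hζ := by
    intro k
    induction k with
    | zero => exact ⟨m, by simp⟩
    | succ k ih =>
      rw [pow_succ', mul_smul]
      exact genH_smul_mem_diagonalPart ih
  obtain ⟨n, hn⟩ := h2 (2 * l)
  rw [h, smul_smul, ← pow_add, show 2 * l + l = 3 * l by ring, pow_mul, genH_pow, one_pow,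
    one_smul] at hn
  simp only [pointR, pointP, Projectivization.smul_mk] at hn
  have e1 := torusInv_of_mk_eq_mk hn 0 1
  have e2 := torusInv_of_mk_eq_mk hn 0 2
  rw [torusInv_genG, torusInv_genG] at e1 e2
  simp [torusInv] at e1 e2
  apply (torusInv_pointR hζ).2
  simp only [torusInv]
  rw [pow_two]
  nth_rewrite 1 [show vecR ζ 0 ^ 3 * vecR ζ (0 + 1) = _ from e1]
  rw [show vecR ζ 0 ^ 3 * vecR ζ (0 + 1) = _ from e2]
  rfl

lemma ncard_O28 (hζ : IsPrimitiveRoot ζ 7) : (O28 hζ).ncard = 28 := by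
  have h1 : (diagonalPart hζ).ncard = 7 := by
    rw [diagonalPart_eq, Set.InjOn.ncard_image, Set.ncard_coe_finset, Finset.card_range]
    intro m hm m' hm' h
    simp only [Finset.coe_range, Set.mem_Iio] at hm hm'
    exact genG_pow_smul_inj hζ _ (by simp) (by simp) hm hm' h
  have h2 : (mainPart hζ).ncard = 21 := by
    rw [mainPart_eq, (mainPart_injOn hζ).ncard_image, Set.ncard_coe_finset]
    rfl
  rw [O28_eq, Set.ncard_union_eq (disjoint_parts hζ) (Set.finite_of_ncard_ne_zero (by omega))
    (Set.finite_of_ncard_ne_zero (by omega)), h1, h2]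

/-! ### Truncated power series -/

/-- The truncated power series `a + b T + c T² + d T³`, for use when `T⁴ = 0`. -/
def trunc {A : Type*} [CommRing A] (T a b c d : A) : A := a + b * T + c * T ^ 2 + d * T ^ 3

section trunc

variable {A : Type*} [CommRing A] {T : A}

lemma trunc_mul (hT : T ^ 4 = 0) (a b c d a' b' c' d' : A) :
    trunc T a b c d * trunc T a' b' c' d' = trunc T (a * a') (a * b' + b * a')
      (a * c' + b * b' + c * a') (a * d' + b * c' + c * b' + d * a') := by
  unfold trunc
  linear_combination (b * d' + c * c' + d * b' + (c * d' + d * c') * T + d * d' * T ^ 2) * hT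

lemma trunc_add (a b c d a' b' c' d' : A) : trunc T a b c d + trunc T a' b' c' d' =
    trunc T (a + a') (b + b') (c + c') (d + d') := by
  unfold trunc
  ring

lemma trunc_sub (a b c d a' b' c' d' : A) : trunc T a b c d - trunc T a' b' c' d' =
    trunc T (a - a') (b - b') (c - c') (d - d') := by
  unfold trunc
  ring

lemma mul_trunc (r a b c d : A) : r * trunc T a b c d =
    trunc T (r * a) (r * b) (r * c) (r * d) := by
  unfold trunc
  ring

lemma one_add_pow_eq_trunc (hT : T ^ 4 = 0) (y : A) (n : ℕ) : (1 + T * y) ^ n =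
    trunc T 1 (n * y) (n.choose 2 * y ^ 2) (n.choose 3 * y ^ 3) := by
  induction n with
  | zero => simp [trunc]
  | succ n ih =>
    have h : (1 + T * y) = trunc T 1 y 0 0 := by
      unfold trunc
      ring
    rw [pow_succ, ih, h, trunc_mul hT, Nat.choose_succ_succ' n 1, Nat.choose_succ_succ' n 2,
      Nat.choose_one_right]
    push_cast
    congr 1 <;> ring

end trunc

set_option maxHeartbeats 1000000 in
/-- The Taylor expansion of `Phi21` at `(1, 1, 1)` up to order 3. -/
lemma aeval_Phi21_one_add {A : Type*} [CommRing A] [Algebra ℂ A] {T : A} (hT : T ^ 4 = 0)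
    (Y : Fin 3 → A) : aeval (fun i => 1 + T * Y i) Phi21 =
      T ^ 3 * (56 ^ 3 * (Y 0 ^ 3 + Y 1 ^ 3 + Y 2 ^ 3 - Y 0 ^ 2 * Y 1 - Y 1 ^ 2 * Y 2
        - Y 2 ^ 2 * Y 0 - 2 * (Y 0 * Y 1 ^ 2 + Y 1 * Y 2 ^ 2 + Y 2 * Y 0 ^ 2)
        + 6 * (Y 0 * Y 1 * Y 2))) := by
  rw [Phi21_eq]
  simp only [map_add, map_sub, map_mul, map_pow, aeval_X, map_ofNat]
  have h1 : ∀ i, 1 + T * Y i = trunc T 1 (Y i) 0 0 := fun i => by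
    unfold trunc
    ring
  have h0 : ∀ i n, (1 + T * Y i) ^ n = _ := fun i n => one_add_pow_eq_trunc hT (Y i) n
  simp only [h0]
  simp only [h1, trunc_mul hT, mul_trunc, trunc_add, trunc_sub]
  trans trunc T 0 0 0 (56 ^ 3 * (Y 0 ^ 3 + Y 1 ^ 3 + Y 2 ^ 3 - Y 0 ^ 2 * Y 1 - Y 1 ^ 2 * Y 2
        - Y 2 ^ 2 * Y 0 - 2 * (Y 0 * Y 1 ^ 2 + Y 1 * Y 2 ^ 2 + Y 2 * Y 0 ^ 2)
        + 6 * (Y 0 * Y 1 * Y 2)))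
  · generalize Y 0 = x
    generalize Y 1 = y
    generalize Y 2 = z
    simp only [Nat.choose, Nat.reduceAdd, Nat.cast_ofNat, Nat.cast_one, Nat.cast_zero]
    congr 1
    · ring
    · ring
    · ring
    · ring
  · unfold trunc
    ring

/-! ### Ordinary triple points -/

/-- The form `F` vanishes to order 3 at the vector `v`, and its tangent cone at `v` is the product
of the linear forms with coefficients `a j`. The expansion of `F` at `v` is evaluated in arbitrary
`ℂ`-algebras, along `v + T Y` with `T⁴ = 0`, which makes substitutions into the expansion
immediate. -/
def HasTangentCone (F : S) (v : Fin 3 → ℂ) (a : Fin 3 → Fin 3 → ℂ) : Prop :=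
  ∀ (A : Type) [CommRing A] [Algebra ℂ A] (T : A) (Y : Fin 3 → A), T ^ 4 = 0 →
    aeval (fun i => algebraMap ℂ A (v i) + T * Y i) F =
      T ^ 3 * ∏ j, ∑ i, algebraMap ℂ A (a j i) * Y i

/-- The tangent cone of `F` at the vector `v` consists of three distinct lines. -/
def IsTripleVec (F : S) (v : Fin 3 → ℂ) : Prop :=
  ∃ a : Fin 3 → Fin 3 → ℂ, (∀ j k, j ≠ k → LinearIndependent ℂ ![a j, a k]) ∧
    HasTangentCone F v a

lemma linearIndependent_vecMul {N : Matrix (Fin 3) (Fin 3) ℂ} (hN : N.det ≠ 0)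
    {a b : Fin 3 → ℂ} (h : LinearIndependent ℂ ![a, b]) :
    LinearIndependent ℂ ![Matrix.vecMul a N, Matrix.vecMul b N] := by
  rw [LinearIndependent.pair_iff] at h ⊢
  intro s t hst
  rw [← Matrix.smul_vecMul, ← Matrix.smul_vecMul, ← Matrix.add_vecMul] at hst
  exact h s t (Matrix.eq_zero_of_vecMul_eq_zero hN hst)

/-- Pulling back a tangent cone of three distinct lines along an invertible linear map. -/
lemma IsTripleVec.of_forall {F G : S} {v w : Fin 3 → ℂ} (hF : IsTripleVec F v)
    {N : Matrix (Fin 3) (Fin 3) ℂ} (hN : N.det ≠ 0)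
    (h : ∀ a, HasTangentCone F v a → HasTangentCone G w fun j => Matrix.vecMul (a j) N) :
    IsTripleVec G w := by
  obtain ⟨a, ha, hc⟩ := hF
  exact ⟨_, fun j k hjk => linearIndependent_vecMul hN (ha j k hjk), h a hc⟩

lemma sum_vecMul {A : Type*} [CommRing A] [Algebra ℂ A] (a : Fin 3 → ℂ)
    (N : Matrix (Fin 3) (Fin 3) ℂ) (Y : Fin 3 → A) :
    ∑ i, algebraMap ℂ A (Matrix.vecMul a N i) * Y i =
      ∑ i, algebraMap ℂ A (a i) * ∑ j, algebraMap ℂ A (N i j) * Y j := by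
  simp [Matrix.vecMul, dotProduct, Fin.sum_univ_three]
  ring

lemma aeval_mul_Phi21 {A : Type*} [CommRing A] [Algebra ℂ A] (c : A) (y : Fin 3 → A) :
    aeval (fun i => c * y i) Phi21 = c ^ 21 * aeval y Phi21 := by
  rw [Phi21_eq]
  simp only [map_add, map_sub, map_mul, map_pow, aeval_X, map_ofNat]
  generalize y 0 = x0
  generalize y 1 = x1
  generalize y 2 = x2
  ring

lemma isTripleVec_smul {v : Fin 3 → ℂ} (h : IsTripleVec Phi21 v) {c : ℂ} (hc : c ≠ 0) :
    IsTripleVec Phi21 (c • v) := by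
  -- `F (c v + T Y) = c²¹ F (v + c⁻¹ T Y)`, so every factor of the cone is scaled by `c⁶`.
  refine h.of_forall (N := Matrix.diagonal fun _ => c ^ 6) (by simp [hc]) ?_
  intro a ha A _ _ T Y hT
  have e : (fun i => algebraMap ℂ A ((c • v) i) + T * Y i) = fun i => algebraMap ℂ A c *
      (algebraMap ℂ A (v i) + T * (algebraMap ℂ A c⁻¹ * Y i)) := by
    funext i
    have : algebraMap ℂ A c * algebraMap ℂ A c⁻¹ = 1 := by
      rw [← map_mul, mul_inv_cancel₀ hc, map_one]
    rw [Pi.smul_apply, smul_eq_mul, map_mul]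
    linear_combination -(T * Y i) * this
  have hcc : algebraMap ℂ A c ^ 21 * algebraMap ℂ A c⁻¹ ^ 3 = algebraMap ℂ A (c ^ 6) ^ 3 := by
    rw [← map_pow, ← map_pow, ← map_pow, ← map_mul]
    congr 1
    field_simp
  rw [e, aeval_mul_Phi21, ha A T _ hT]
  simp only [Matrix.vecMul_diagonal, Fin.prod_univ_three, Fin.sum_univ_three, map_mul]
  linear_combination T ^ 3 * (algebraMap ℂ A (a 0 0) * Y 0 + algebraMap ℂ A (a 0 1) * Y 1
    + algebraMap ℂ A (a 0 2) * Y 2) * (algebraMap ℂ A (a 1 0) * Y 0 + algebraMap ℂ A (a 1 1) * Y 1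
    + algebraMap ℂ A (a 1 2) * Y 2) * (algebraMap ℂ A (a 2 0) * Y 0 + algebraMap ℂ A (a 2 1) * Y 1
    + algebraMap ℂ A (a 2 2) * Y 2) * hcc

/-- `F (M v + T Y) = F (v + T M⁻¹ Y)` when `F` is invariant under `M`. -/
lemma isTripleVec_mulVec {F : S} {v : Fin 3 → ℂ} (h : IsTripleVec F v)
    {M : Matrix (Fin 3) (Fin 3) ℂ} (hM : M.det = 1) (hF : subst M F = F) :
    IsTripleVec F (M.mulVec v) := by
  have hu : IsUnit M.det := by simp [hM]
  refine h.of_forall (N := M⁻¹) (by simp [hM]) ?_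
  intro a ha A _ _ T Y hT
  simp only [sum_vecMul]
  rw [← ha A T _ hT]
  conv_rhs => rw [← hF, aeval_subst]
  congr 2
  funext i
  have h1 : ∀ k, ∑ j, algebraMap ℂ A (M i j) * algebraMap ℂ A (M⁻¹ j k) =
      algebraMap ℂ A ((1 : Matrix (Fin 3) (Fin 3) ℂ) i k) := fun k => by
    rw [← Matrix.mul_nonsing_inv M hu, Matrix.mul_apply, map_sum]
    simp only [map_mul]
  have h2 : Y i = ∑ k, algebraMap ℂ A ((1 : Matrix (Fin 3) (Fin 3) ℂ) i k) * Y k := by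
    simp [Matrix.one_apply]
  rw [h2]
  simp only [← h1, Matrix.mulVec, dotProduct, Fin.sum_univ_three, map_add, map_mul]
  ring

/-- Taylor's formula to first order. -/
lemma exists_aeval_add_eq {A : Type*} [CommRing A] [Algebra ℂ A] (v : Fin 3 → ℂ) (T : A)
    (Y : Fin 3 → A) (F : S) : ∃ q, aeval (fun i => algebraMap ℂ A (v i) + T * Y i) F =
      algebraMap ℂ A (eval v F) +
        T * (∑ j, algebraMap ℂ A (eval v (pderiv j F)) * Y j + T * q) := by
  induction F using MvPolynomial.induction_on with
  | C a => exact ⟨0, by simp⟩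
  | add p q hp hq =>
    obtain ⟨r, hr⟩ := hp
    obtain ⟨s, hs⟩ := hq
    refine ⟨r + s, ?_⟩
    simp only [map_add, hr, hs, add_mul, Finset.sum_add_distrib]
    ring
  | mul_X p n hp =>
    obtain ⟨r, hr⟩ := hp
    refine ⟨r * algebraMap ℂ A (v n) + (∑ j, algebraMap ℂ A (eval v (pderiv j p)) * Y j) * Y n
      + T * r * Y n, ?_⟩
    have h1 : ∑ j, algebraMap ℂ A (eval v (pderiv j (p * X n))) * Y j =
        algebraMap ℂ A (eval v p) * Y n +
        algebraMap ℂ A (v n) * ∑ j, algebraMap ℂ A (eval v (pderiv j p)) * Y j := by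
      have h2 : ∀ j, algebraMap ℂ A (eval v (pderiv j (p * X n))) * Y j =
          (if j = n then algebraMap ℂ A (eval v p) * Y n else 0) +
          algebraMap ℂ A (v n) * (algebraMap ℂ A (eval v (pderiv j p)) * Y j) := fun j => by
        rw [Derivation.leibniz, pderiv_X, smul_eq_mul, smul_eq_mul, map_add, map_mul, map_mul,
          eval_X, map_add, map_mul, map_mul]
        by_cases h : j = n
        · rw [if_pos h, h, Pi.single_eq_same, map_one, map_one]
          ring
        · rw [if_neg h, Pi.single_eq_of_ne (Ne.symm h), map_zero, map_zero]
          ring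
      rw [Finset.sum_congr rfl fun j _ => h2 j, Finset.sum_add_distrib, ← Finset.mul_sum]
      simp
    rw [h1, map_mul, hr, aeval_X, map_mul, eval_X, map_mul]
    ring

/-- At a point where the Hessian of `Phi4` does not vanish the gradient map is a local isomorphism,
and the tangent cone of `Phi63` is the pullback of that of `Phi21` under the Hessian matrix. -/
lemma isTripleVec_Phi63 {v : Fin 3 → ℂ} (hv : eval v (hessian Phi4).det ≠ 0)
    (h : IsTripleVec Phi21 (gradVec v)) : IsTripleVec Phi63 v := by
  refine h.of_forall (N := (hessian Phi4).map (eval v)) ?_ ?_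
  · rwa [RingHom.map_det] at hv
  intro a ha A _ _ T Y hT
  choose q hq using fun i => exists_aeval_add_eq v T Y (pderiv i Phi4)
  have hsymm : ∀ i j, pderiv j (pderiv i Phi4) = hessian Phi4 i j := by
    intro i j
    change hessian Phi4 j i = _
    rw [hessian_Phi4]
    fin_cases i <;> fin_cases j <;> simp
  have e : aeval (fun i => algebraMap ℂ A (v i) + T * Y i) Phi63 =
      aeval (fun i => algebraMap ℂ A (gradVec v i) +
        T * (∑ j, algebraMap ℂ A ((hessian Phi4).map (eval v) i j) * Y j + T * q i)) Phi21 := by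
    rw [Phi63, aeval_bind₁]
    congr 2
    funext i
    rw [hq]
    simp only [hsymm]
    rfl
  rw [e, ha A T _ hT]
  simp only [sum_vecMul]
  generalize (fun i => ∑ j, algebraMap ℂ A ((hessian Phi4).map (eval v) i j) * Y j) = Z
  have h3 : ∀ j, ∑ i, algebraMap ℂ A (a j i) *
      (∑ k, algebraMap ℂ A ((hessian Phi4).map (eval v) i k) * Y k + T * q i) =
      (∑ i, algebraMap ℂ A (a j i) *
        ∑ k, algebraMap ℂ A ((hessian Phi4).map (eval v) i k) * Y k) +
      T * ∑ i, algebraMap ℂ A (a j i) * q i := fun j => by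
    simp only [mul_add, Finset.sum_add_distrib, Finset.mul_sum, mul_left_comm]
  simp only [h3, Fin.prod_univ_three]
  generalize (∑ i, algebraMap ℂ A (a 0 i) *
        ∑ k, algebraMap ℂ A ((hessian Phi4).map (eval v) i k) * Y k) = x
  generalize (∑ i, algebraMap ℂ A (a 1 i) *
        ∑ k, algebraMap ℂ A ((hessian Phi4).map (eval v) i k) * Y k) = y
  generalize (∑ i, algebraMap ℂ A (a 2 i) *
        ∑ k, algebraMap ℂ A ((hessian Phi4).map (eval v) i k) * Y k) = z
  generalize ∑ i, algebraMap ℂ A (a 0 i) * q i = x'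
  generalize ∑ i, algebraMap ℂ A (a 1 i) * q i = y'
  generalize ∑ i, algebraMap ℂ A (a 2 i) * q i = z'
  linear_combination (x' * y * z + x * y' * z + x * y * z' + T * (x' * y' * z + x' * y * z'
    + x * y' * z') + T ^ 2 * (x' * y' * z')) * hT

/-- The tangent cone of Klein's arrangement of lines at `[1 : 1 : 1]`: it is invariant under cyclic
permutations, so it is a combination of the cubes of the two eigenforms `x + ω²y + ωz` and
`x + ωy + ω²z`. -/
lemma isTripleVec_Phi21_one (hω : IsPrimitiveRoot ω 3) :
    IsTripleVec Phi21 ![1, 1, 1] := by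
  have h := cube_root_relation hω
  obtain ⟨p, hp⟩ := IsAlgClosed.exists_pow_nat_eq (56 ^ 3 * (5 + ω) / 9) (n := 3) (by norm_num)
  obtain ⟨q, hq⟩ := IsAlgClosed.exists_pow_nat_eq (56 ^ 3 * (4 - ω) / 9) (n := 3) (by norm_num)
  have hp0 : p ≠ 0 := by
    rintro rfl
    grind
  have hq0 : q ≠ 0 := by
    rintro rfl
    grind
  refine ⟨fun j => ![p + ω ^ (j : ℕ) * q, p * ω ^ 2 + ω ^ (j : ℕ) * q * ω,
    p * ω + ω ^ (j : ℕ) * q * ω ^ 2], ?_, ?_⟩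
  · intro j k hjk
    have hne : ω ^ (j : ℕ) ≠ ω ^ (k : ℕ) := fun h' => hjk (Fin.ext (hω.pow_inj j.2 k.2 h'))
    rw [LinearIndependent.pair_iff]
    intro s t hst
    have h0 : s * (p + ω ^ (j : ℕ) * q) + t * (p + ω ^ (k : ℕ) * q) = 0 := congrFun hst 0
    have h1 : s * (p * ω ^ 2 + ω ^ (j : ℕ) * q * ω) + t * (p * ω ^ 2 + ω ^ (k : ℕ) * q * ω) = 0 :=
      congrFun hst 1
    have h2 : s * (p * ω + ω ^ (j : ℕ) * q * ω ^ 2) + t * (p * ω + ω ^ (k : ℕ) * q * ω ^ 2) = 0 :=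
      congrFun hst 2
    generalize ω ^ (j : ℕ) = a at h0 h1 h2 hne
    generalize ω ^ (k : ℕ) = b at h0 h1 h2 hne
    have e1 : p * (s + t) = 0 := by grind
    have e2 : q * (s * a + t * b) = 0 := by grind
    have e1' : s + t = 0 := (mul_eq_zero.1 e1).resolve_left hp0
    have e2' : s * a + t * b = 0 := (mul_eq_zero.1 e2).resolve_left hq0
    have e3 : s * (a - b) = 0 := by linear_combination e2' - b * e1'
    have hs : s = 0 := (mul_eq_zero.1 e3).resolve_right (sub_ne_zero.2 hne)
    exact ⟨hs, by simpa [hs] using e1'⟩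
  · intro A _ _ T Y hT
    have e : (fun i => algebraMap ℂ A (![1, 1, 1] i) + T * Y i) = fun i => 1 + T * Y i := by
      funext i
      fin_cases i <;> simp
    rw [e, aeval_Phi21_one_add hT]
    congr 1
    have hw : algebraMap ℂ A ω ^ 2 + algebraMap ℂ A ω + 1 = 0 := by
      simpa using congrArg (algebraMap ℂ A) h
    have hc : 9 * algebraMap ℂ A (1 / 9) = 1 := by
      rw [← map_ofNat (algebraMap ℂ A) 9, ← map_mul]
      norm_num
    have hp' : algebraMap ℂ A p ^ 3 = 56 ^ 3 * (5 + algebraMap ℂ A ω) * algebraMap ℂ A (1 / 9) := by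
      rw [← map_pow, hp, div_eq_mul_one_div, map_mul, map_mul, map_add, map_pow, map_ofNat,
        map_ofNat]
    have hq' : algebraMap ℂ A q ^ 3 = 56 ^ 3 * (4 - algebraMap ℂ A ω) * algebraMap ℂ A (1 / 9) := by
      rw [← map_pow, hq, div_eq_mul_one_div, map_mul, map_mul, map_sub, map_pow, map_ofNat,
        map_ofNat]
    have e2 : ∏ j : Fin 3, ∑ i, algebraMap ℂ A (![p + ω ^ (j : ℕ) * q,
        p * ω ^ 2 + ω ^ (j : ℕ) * q * ω, p * ω + ω ^ (j : ℕ) * q * ω ^ 2] i) * Y i =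
        algebraMap ℂ A p ^ 3 * (Y 0 + algebraMap ℂ A ω ^ 2 * Y 1 + algebraMap ℂ A ω * Y 2) ^ 3 +
        algebraMap ℂ A q ^ 3 * (Y 0 + algebraMap ℂ A ω * Y 1 + algebraMap ℂ A ω ^ 2 * Y 2) ^ 3 := by
      simp [Fin.prod_univ_three, Fin.sum_univ_three]
      clear hp' hq' hc
      grind
    rw [e2, hp', hq']
    clear hp' hq' e2
    grind

/-! ### Homogeneous components of the Taylor expansion -/

/-- The homogeneous components of `G` are the coefficients of `G (T x, T y, T z)`. -/
lemma coeff_aeval_X_mul (G : S) (k : ℕ) :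
    (aeval (fun i => (Polynomial.X : Polynomial S) * Polynomial.C (X i)) G).coeff k =
      homogeneousComponent k G := by
  induction G using MvPolynomial.induction_on' with
  | add p q hp hq => rw [map_add, Polynomial.coeff_add, hp, hq, map_add]
  | monomial d c =>
    have h : aeval (fun i => (Polynomial.X : Polynomial S) * Polynomial.C (X i)) (monomial d c) =
        Polynomial.C (monomial d c) * Polynomial.X ^ d.degree := by
      rw [aeval_monomial, monomial_eq (s := d), map_mul, Finsupp.prod, Finsupp.prod, map_prod]
      simp only [mul_pow, Finset.prod_mul_distrib, Finset.prod_pow_eq_pow_sum, map_pow]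
      rw [show d.degree = ∑ i ∈ d.support, d i from rfl]
      simp only [Polynomial.algebraMap_apply, MvPolynomial.algebraMap_eq]
      ring
    rw [h, Polynomial.coeff_C_mul_X_pow,
      homogeneousComponent_of_mem (isHomogeneous_monomial c rfl)]

lemma HasTangentCone.map_translate {F : S} {v : Fin 3 → ℂ} {a : Fin 3 → Fin 3 → ℂ}
    (h : HasTangentCone F v a) {B : Type} [CommRing B] [Algebra ℂ B] (π : Polynomial S →ₐ[ℂ] B)
    (hT : π Polynomial.X ^ 4 = 0) :
    π (aeval (fun i => (Polynomial.X : Polynomial S) * Polynomial.C (X i)) (translate v F)) =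
      π (Polynomial.X ^ 3 * Polynomial.C (∏ j, ∑ i, C (a j i) * X i)) := by
  have hC : ∀ c : ℂ, π (Polynomial.C (C c)) = algebraMap ℂ B c := fun c => π.commutes c
  have key := h B (π Polynomial.X) (fun i => π (Polynomial.C (X i))) hT
  have e1 : (fun i => aeval (fun i => π ((Polynomial.X : Polynomial S) * Polynomial.C (X i)))
      (C (v i) + X i : S)) =
      fun i => algebraMap ℂ B (v i) + π Polynomial.X * π (Polynomial.C (X i)) := by
    funext i
    rw [map_add, aeval_X, aeval_C, map_mul]
  rw [translate, comp_aeval_apply, aeval_bind₁]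
  refine (congrArg (fun f => aeval f F) e1).trans (key.trans ?_)
  simp only [map_mul, map_pow, map_prod, map_sum, hC]

/-- The tangent cone is read off from the expansion in the algebra `S[T] / (T⁴)`. -/
lemma homogeneousComponent_translate {F : S} {v : Fin 3 → ℂ} {a : Fin 3 → Fin 3 → ℂ}
    (h : HasTangentCone F v a) {k : ℕ} (hk : k < 4) :
    homogeneousComponent k (translate v F) =
      if k = 3 then ∏ j, ∑ i, C (a j i) * X i else 0 := by
  let π : Polynomial S →ₐ[ℂ] Polynomial S ⧸ Ideal.span {(Polynomial.X : Polynomial S) ^ 4} :=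
    Ideal.Quotient.mkₐ ℂ _
  have hT : π Polynomial.X ^ 4 = 0 := by
    rw [← map_pow]
    exact Ideal.Quotient.eq_zero_iff_mem.2 (Ideal.mem_span_singleton_self _)
  have hq := HasTangentCone.map_translate
    (B := Polynomial S ⧸ Ideal.span {(Polynomial.X : Polynomial S) ^ 4}) h π hT
  rw [Ideal.Quotient.mkₐ_eq_mk, Ideal.Quotient.mk_eq_mk_iff_sub_mem] at hq
  have hdvd := Ideal.mem_span_singleton.1 hq
  have hc := Polynomial.X_pow_dvd_iff.1 hdvd k hk
  rw [Polynomial.coeff_sub, sub_eq_zero, coeff_aeval_X_mul, Polynomial.coeff_X_pow_mul',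
    Polynomial.coeff_C] at hc
  rw [hc]
  split_ifs <;> first | rfl | omega

lemma isOrdinaryTriplePoint_of_isTripleVec {F : S} {p : P2} (h : IsTripleVec F p.rep) :
    IsOrdinaryTriplePoint F p := by
  obtain ⟨a, ha, hc⟩ := h
  refine ⟨fun k hk => ?_, a, ha, ?_⟩
  · rw [homogeneousComponent_translate hc (by omega), if_neg (by omega)]
  · rw [homogeneousComponent_translate hc (by omega), if_pos rfl]

/-! ### Counting orbits through the fibres of the gradient map -/

lemma orbit_pointQ (hζ : IsPrimitiveRoot ζ 7) (ω : ℂ) : orbit hζ (pointQ ω) = O56 hζ ω := rfl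

lemma smul_mem_orbit {hζ : IsPrimitiveRoot ζ 7} {M : Matrix.SpecialLinearGroup (Fin 3) ℂ}
    (hM : M ∈ group hζ) {p q : P2} (h : q ∈ orbit hζ p) : M • q ∈ orbit hζ p := by
  obtain ⟨N, hN, rfl⟩ := mem_orbit_iff.1 h
  exact mem_orbit_iff.2 ⟨M * N, mul_mem hM hN, mul_smul _ _ _⟩

lemma mem_orbit_self (hζ : IsPrimitiveRoot ζ 7) (p : P2) : p ∈ orbit hζ p :=
  mem_orbit_iff.2 ⟨1, one_mem _, one_smul _ _⟩

/-- The part of the orbit of `x` lying over `N • pointP` is a translate of the part lying over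
`pointP`. -/
lemma inter_preimage_smul {hζ : IsPrimitiveRoot ζ 7} {N : Matrix.SpecialLinearGroup (Fin 3) ℂ}
    (hN : N ∈ group hζ) {A : Set P2}
    (hA : ∀ M ∈ group hζ, ∀ p ∈ A, M • p ∈ A) :
    A ∩ gradientMap ⁻¹' {N • pointP} =
      (fun p => contragredient N • p) '' (A ∩ gradientMap ⁻¹' {pointP}) := by
  have hM := contragredient_mem hN
  ext p
  constructor
  · rintro ⟨hp, hp'⟩
    have hp' : gradientMap p = N • pointP := hp'
    refine ⟨(contragredient N)⁻¹ • p, ⟨hA _ (inv_mem hM) p hp, ?_⟩, smul_inv_smul _ _⟩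
    change gradientMap _ = pointP
    rw [gradientMap_smul (inv_mem hM), map_inv, contragredient_contragredient, hp', inv_smul_smul]
  · rintro ⟨q, ⟨hq, hq'⟩, rfl⟩
    have hq' : gradientMap q = pointP := hq'
    refine ⟨hA _ hM q hq, ?_⟩
    change gradientMap (contragredient N • q) = N • pointP
    rw [gradientMap_smul hM, contragredient_contragredient, hq']

/-- An invariant set meets all fibres over the orbit of `[1 : 1 : 1]` in equally many points. -/
lemma ncard_inter_preimage {hζ : IsPrimitiveRoot ζ 7} {A : Set P2}
    (hA : ∀ M ∈ group hζ, ∀ p ∈ A, M • p ∈ A) {y : P2} (hy : y ∈ O28 hζ) :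
    (A ∩ gradientMap ⁻¹' {y}).ncard = (A ∩ gradientMap ⁻¹' {pointP}).ncard := by
  obtain ⟨N, hN, rfl⟩ := mem_orbit_iff.1 hy
  rw [show Projectivization.mk ℂ ![1, 1, 1] _ = pointP from rfl, inter_preimage_smul hN hA]
  exact Set.ncard_image_of_injective _ (MulAction.injective _)

lemma ncard_eq_mul_of_fibres {α β : Type*} {f : α → β} {A : Set α} {B : Set β} {n : ℕ}
    (hB : B.Finite) (hn : n ≠ 0) (hf : Set.MapsTo f A B)
    (h : ∀ y ∈ B, (A ∩ f ⁻¹' {y}).ncard = n) : A.ncard = B.ncard * n := by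
  classical
  have hA : A.Finite := by
    have hU : (⋃ y ∈ B, A ∩ f ⁻¹' {y}).Finite :=
      hB.biUnion fun y hy => Set.finite_of_ncard_ne_zero (by rw [h y hy]; exact hn)
    exact hU.subset fun x hx => Set.mem_biUnion (hf hx) ⟨hx, rfl⟩
  lift A to Finset α using hA
  lift B to Finset β using hB
  rw [Set.ncard_coe_finset, Set.ncard_coe_finset, Finset.card_eq_sum_card_fiberwise hf,
    Finset.sum_const_nat]
  intro y hy
  rw [← h y hy, ← Set.ncard_coe_finset]
  congr 1
  ext x
  simp

lemma mapsTo_gradientMap_orbit (hζ : IsPrimitiveRoot ζ 7) {x : P2} (hx : gradientMap x = pointP) :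
    Set.MapsTo gradientMap (orbit hζ x) (O28 hζ) := by
  intro y hy
  obtain ⟨M, hM, rfl⟩ := mem_orbit_iff.1 hy
  rw [gradientMap_smul hM, hx]
  exact smul_mem_orbit (contragredient_mem hM) (mem_orbit_self hζ pointP)

/-- An orbit meeting the fibre over `[1 : 1 : 1]` in `n` points has `28 n` points. -/
lemma ncard_orbit {hζ : IsPrimitiveRoot ζ 7} {x : P2} (hx : gradientMap x = pointP) {n : ℕ}
    (hn : n ≠ 0) (h : (orbit hζ x ∩ gradientMap ⁻¹' {pointP}).ncard = n) :
    (orbit hζ x).ncard = 28 * n := by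
  rw [← ncard_O28 hζ]
  refine ncard_eq_mul_of_fibres (Set.finite_of_ncard_ne_zero (by rw [ncard_O28]; norm_num)) hn
    (mapsTo_gradientMap_orbit hζ hx) fun y hy => ?_
  rw [← h]
  exact ncard_inter_preimage (fun M hM p hp => smul_mem_orbit hM hp) hy

/-! ### Separation of the points of the fibre by invariants -/

/-- The forms `Phi4` and `Phi6` take the values `a` and `b` at some vector representing `p`. -/
def HasInvariants (p : P2) (a b : ℂ) : Prop :=
  ∃ (v : Fin 3 → ℂ) (hv : v ≠ 0), p = Projectivization.mk ℂ v hv ∧ eval v Phi4 = a ∧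
    eval v Phi6 = b

lemma eval_smul_Phi4 (c : ℂ) (v : Fin 3 → ℂ) : eval (c • v) Phi4 = c ^ 4 * eval v Phi4 := by
  simp [Phi4]
  ring

lemma eval_smul_Phi6 (c : ℂ) (v : Fin 3 → ℂ) : eval (c • v) Phi6 = c ^ 6 * eval v Phi6 := by
  simp [Phi6_eq]
  ring

lemma eval_group_Phi4 {hζ : IsPrimitiveRoot ζ 7} {M : Matrix.SpecialLinearGroup (Fin 3) ℂ}
    (hM : M ∈ group hζ) (v : Fin 3 → ℂ) : eval (M • v) Phi4 = eval v Phi4 := by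
  conv_rhs => rw [← subst_Phi4 hM, eval_subst]
  rfl

lemma eval_group_Phi6 {hζ : IsPrimitiveRoot ζ 7} {M : Matrix.SpecialLinearGroup (Fin 3) ℂ}
    (hM : M ∈ group hζ) (v : Fin 3 → ℂ) : eval (M • v) Phi6 = eval v Phi6 := by
  conv_rhs => rw [← subst_Phi6 M.2 (subst_Phi4 hM), eval_subst]
  rfl

/-- The quotient `Phi4³ / Phi6²` is constant on orbits; the denominators are cleared. -/
lemma HasInvariants.eq_of_mem_orbit {hζ : IsPrimitiveRoot ζ 7} {p q : P2} {a b a' b' : ℂ}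
    (hp : HasInvariants p a b) (hq : HasInvariants q a' b') (h : q ∈ orbit hζ p) :
    a' ^ 3 * b ^ 2 = a ^ 3 * b' ^ 2 := by
  obtain ⟨v, hv, rfl, rfl, rfl⟩ := hp
  obtain ⟨w, hw, rfl, rfl, rfl⟩ := hq
  obtain ⟨M, hM, h⟩ := mem_orbit_iff.1 h
  rw [Projectivization.smul_mk, Projectivization.mk_eq_mk_iff'] at h
  obtain ⟨c, hc⟩ := h
  rw [← eval_group_Phi4 hM v, ← eval_group_Phi6 hM v, ← hc, eval_smul_Phi4, eval_smul_Phi6]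
  ring

lemma hasInvariants_pointP : HasInvariants pointP 3 (-2) :=
  ⟨_, _, rfl, eval_Phi4_pointP, eval_Phi6_pointP⟩

lemma hasInvariants_pointQ (h : ω ^ 2 + ω + 1 = 0) : HasInvariants (pointQ ω) 0 (3 * ω - 5) :=
  ⟨_, _, rfl, eval_Phi4_pointQ h, eval_Phi6_pointQ h⟩

lemma hasInvariants_of_mem_fibrePart {h : ω ^ 2 + ω + 1 = 0} {e : ℂ}
    (he : 14 * e ^ 2 = 7 * e + 1) {p : P2} (hp : p ∈ fibrePart h e) :
    HasInvariants p (63 * (1 + 5 * e) / 8) (-189 * (23 + 203 * e) / 16) := by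
  obtain ⟨u, hu, rfl⟩ := hp
  exact ⟨_, _, rfl, eval_Phi4_fibreVec h he hu, eval_Phi6_fibreVec h he hu⟩

lemma genI_smul_pointQ (hζ : IsPrimitiveRoot ζ 7) (h : ω ^ 2 + ω + 1 = 0) :
    genI hζ • pointQ ω = pointQ' ω := by
  rw [pointQ, pointQ', Projectivization.smul_mk]
  apply mk_eq_mk_of_minors <;> rw [genI_smul_vec] <;> simp <;> grind

lemma pointQ'_mem_orbit (hζ : IsPrimitiveRoot ζ 7) (h : ω ^ 2 + ω + 1 = 0) :
    pointQ' ω ∈ orbit hζ (pointQ ω) :=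
  mem_orbit_iff.2 ⟨_, genI_mem hζ, genI_smul_pointQ hζ h⟩

lemma genH_smul_fibreVec (h : ω ^ 2 + ω + 1 = 0) (u e : ℂ) :
    genH • fibreVec ω u e = fibreVec ω (ω * u) e := by
  rw [genH_smul_vec]
  funext i
  fin_cases i <;> simp [fibreVec, fourier] <;> grind

lemma eq_of_cube_eq (h : ω ^ 2 + ω + 1 = 0) {u w : ℂ} (huw : w ^ 3 = u ^ 3) :
    w = u ∨ w = ω * u ∨ w = ω * (ω * u) := by
  have : (w - u) * ((w - ω * u) * (w - ω * (ω * u))) = 0 := by grind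
  simpa [sub_eq_zero] using this

lemma mem_orbit_of_mem_fibrePart (hζ : IsPrimitiveRoot ζ 7) {h : ω ^ 2 + ω + 1 = 0} {e : ℂ}
    {p q : P2} (hp : p ∈ fibrePart h e) (hq : q ∈ fibrePart h e) : q ∈ orbit hζ p := by
  obtain ⟨u, hu, rfl⟩ := hp
  obtain ⟨w, hw, rfl⟩ := hq
  have hH : ∀ u, Projectivization.mk ℂ (fibreVec ω (ω * u) e) (fibreVec_ne_zero h _ e) =
      genH • (Projectivization.mk ℂ (fibreVec ω u e) (fibreVec_ne_zero h u e) : P2) := fun u => by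
    rw [Projectivization.smul_mk]
    congr 1
    exact (genH_smul_fibreVec h u e).symm
  rcases eq_of_cube_eq h (hw.trans hu.symm) with rfl | rfl | rfl
  · exact mem_orbit_self hζ _
  · beta_reduce
    rw [hH]
    exact smul_mem_orbit (genH_mem hζ) (mem_orbit_self hζ _)
  · beta_reduce
    rw [hH, hH]
    exact smul_mem_orbit (genH_mem hζ) (smul_mem_orbit (genH_mem hζ) (mem_orbit_self hζ _))

lemma ncard_fibrePart (hω : IsPrimitiveRoot ω 3) (h : ω ^ 2 + ω + 1 = 0) {e : ℂ}
    (he : 14 * e ^ 2 = 7 * e + 1) : (fibrePart h e).ncard = 3 := by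
  have he0 : e ≠ 0 := by grind
  have hc0 : 7 * (1 + 3 * ω ^ 2) ≠ 0 := by grind
  obtain ⟨u, hu⟩ := IsAlgClosed.exists_pow_nat_eq (7 * (1 + 3 * ω ^ 2)) (n := 3) (by norm_num)
  have hu0 : u ≠ 0 := by
    rintro rfl
    exact hc0 (by rw [← hu]; simp)
  have hset : {w : ℂ | w ^ 3 = 7 * (1 + 3 * ω ^ 2)} = {u, ω * u, ω * (ω * u)} := by
    ext w
    constructor
    · intro hw
      exact eq_of_cube_eq h (Eq.trans hw hu.symm)
    · rintro (rfl | rfl | rfl) <;> simp only [Set.mem_ofPred_eq] <;> grind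
  have hω1 : ω ≠ 1 := hω.ne_one (by norm_num)
  have hω0 : ω ≠ 0 := hω.ne_zero (by norm_num)
  rw [fibrePart, Set.InjOn.ncard_image, hset, Set.ncard_eq_three]
  · refine ⟨_, _, _, ?_, ?_, ?_, rfl⟩ <;> intro h' <;> grind
  · intro w _ w' _ hww
    obtain ⟨c, hc1, hc2, -⟩ := (mk_fourier_eq_iff h _ _).1 hww
    rw [mul_one] at hc1
    rw [hc1, one_mul] at hc2
    exact (mul_left_cancel₀ he0 hc2).symm

lemma orbit_pointP_inter_fibre (hζ : IsPrimitiveRoot ζ 7) (h : ω ^ 2 + ω + 1 = 0) {e e' : ℂ}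
    (he : 14 * e ^ 2 = 7 * e + 1) (hee : e + e' = 1 / 2) :
    orbit hζ pointP ∩ gradientMap ⁻¹' {pointP} = {pointP} := by
  have he' : 14 * e' ^ 2 = 7 * e' + 1 := by grind
  have hne : ∀ {f : ℂ}, 14 * f ^ 2 = 7 * f + 1 → ∀ q ∈ fibrePart h f, q ∉ orbit hζ pointP :=
    fun hf q hq hq' => by
      have := hasInvariants_pointP.eq_of_mem_orbit (hasInvariants_of_mem_fibrePart hf hq) hq'
      grind
  have hQ : pointQ ω ∉ orbit hζ pointP := fun hq => by
    have := hasInvariants_pointP.eq_of_mem_orbit (hasInvariants_pointQ h) hq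
    grind
  have hQ' : pointQ' ω ∉ orbit hζ pointP := fun hq => by
    rw [← genI_smul_pointQ hζ h] at hq
    have := smul_mem_orbit (genI_mem hζ) hq
    rw [genI_smul_genI_smul] at this
    exact hQ this
  apply Set.Subset.antisymm
  · rintro q ⟨hq, hq'⟩
    rcases (mem_fibre_iff h he hee q).1 hq' with rfl | (rfl | rfl) | hq' | hq'
    exacts [rfl, absurd hq hQ, absurd hq hQ', absurd hq (hne he _ hq'), absurd hq (hne he' _ hq')]
  · rintro _ rfl
    exact ⟨mem_orbit_self hζ _, gradientMap_pointP⟩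

lemma orbit_pointQ_inter_fibre (hζ : IsPrimitiveRoot ζ 7) (h : ω ^ 2 + ω + 1 = 0) {e e' : ℂ}
    (he : 14 * e ^ 2 = 7 * e + 1) (hee : e + e' = 1 / 2) :
    orbit hζ (pointQ ω) ∩ gradientMap ⁻¹' {pointP} = {pointQ ω, pointQ' ω} := by
  have he' : 14 * e' ^ 2 = 7 * e' + 1 := by grind
  have hne : ∀ {f : ℂ}, 14 * f ^ 2 = 7 * f + 1 → ∀ q ∈ fibrePart h f, q ∉ orbit hζ (pointQ ω) :=
    fun hf q hq hq' => by
      have := (hasInvariants_pointQ h).eq_of_mem_orbit (hasInvariants_of_mem_fibrePart hf hq) hq'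
      grind
  have hP : pointP ∉ orbit hζ (pointQ ω) := fun hq => by
    have := (hasInvariants_pointQ h).eq_of_mem_orbit hasInvariants_pointP hq
    grind
  apply Set.Subset.antisymm
  · rintro q ⟨hq, hq'⟩
    rcases (mem_fibre_iff h he hee q).1 hq' with rfl | hq' | hq' | hq'
    exacts [absurd hq hP, hq', absurd hq (hne he _ hq'), absurd hq (hne he' _ hq')]
  · rintro _ (rfl | rfl)
    exacts [⟨mem_orbit_self hζ _, gradientMap_pointQ h⟩,
      ⟨pointQ'_mem_orbit hζ h, gradientMap_pointQ' h⟩]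

lemma notMem_orbit_of_mem_fibrePart (hζ : IsPrimitiveRoot ζ 7) {h : ω ^ 2 + ω + 1 = 0} {e e' : ℂ}
    (he : 14 * e ^ 2 = 7 * e + 1) (hee : e + e' = 1 / 2) {p q : P2} (hp : p ∈ fibrePart h e)
    (hq : q ∈ fibrePart h e') : q ∉ orbit hζ p := fun hq' => by
  have he' : 14 * e' ^ 2 = 7 * e' + 1 := by grind
  have := (hasInvariants_of_mem_fibrePart he hp).eq_of_mem_orbit
    (hasInvariants_of_mem_fibrePart he' hq) hq'
  obtain rfl : e' = 1 / 2 - e := by linear_combination hee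
  grind

lemma orbit_inter_fibre (hζ : IsPrimitiveRoot ζ 7) (h : ω ^ 2 + ω + 1 = 0) {e e' : ℂ}
    (he : 14 * e ^ 2 = 7 * e + 1) (hee : e + e' = 1 / 2) {p : P2} (hp : p ∈ fibrePart h e) :
    orbit hζ p ∩ gradientMap ⁻¹' {pointP} = fibrePart h e := by
  have hinv := hasInvariants_of_mem_fibrePart he hp
  have hP : pointP ∉ orbit hζ p := fun hq => by
    have := hinv.eq_of_mem_orbit hasInvariants_pointP hq
    grind
  have hQ : pointQ ω ∉ orbit hζ p := fun hq => by
    have := hinv.eq_of_mem_orbit (hasInvariants_pointQ h) hq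
    grind
  have hQ' : pointQ' ω ∉ orbit hζ p := fun hq => by
    rw [← genI_smul_pointQ hζ h] at hq
    have := smul_mem_orbit (genI_mem hζ) hq
    rw [genI_smul_genI_smul] at this
    exact hQ this
  apply Set.Subset.antisymm
  · rintro q ⟨hq, hq'⟩
    rcases (mem_fibre_iff h he hee q).1 hq' with rfl | (rfl | rfl) | hq' | hq'
    exacts [absurd hq hP, absurd hq hQ, absurd hq hQ', hq',
      absurd hq (notMem_orbit_of_mem_fibrePart hζ he hee hp hq')]
  · exact fun q hq => ⟨mem_orbit_of_mem_fibrePart hζ hp hq, gradientMap_of_mem_fibrePart he hq⟩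

lemma pointQ_ne_pointQ' (hω : IsPrimitiveRoot ω 3) : pointQ ω ≠ pointQ' ω := fun h' => by
  have h := cube_root_relation hω
  have key := minors_of_mk_eq_mk h' 1 2
  simp at key
  have hω1 : ω ≠ 1 := hω.ne_one (by norm_num)
  have hω0 : ω ≠ 0 := hω.ne_zero (by norm_num)
  grind

lemma ncard_fibre (hζ : IsPrimitiveRoot ζ 7) (hω : IsPrimitiveRoot ω 3) {e e' : ℂ}
    (he : 14 * e ^ 2 = 7 * e + 1) (hee : e + e' = 1 / 2) :
    (gradientMap ⁻¹' {pointP}).ncard = 9 := by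
  have h := cube_root_relation hω
  have he' : 14 * e' ^ 2 = 7 * e' + 1 := by grind
  have hP := orbit_pointP_inter_fibre hζ h he hee
  have hQ := orbit_pointQ_inter_fibre hζ h he hee
  have hset : gradientMap ⁻¹' {pointP} =
      ({pointP} ∪ {pointQ ω, pointQ' ω}) ∪ (fibrePart h e ∪ fibrePart h e') := by
    ext p
    rw [Set.mem_preimage, Set.mem_singleton_iff, mem_fibre_iff h he hee]
    simp only [Set.mem_union, Set.mem_insert_iff, Set.mem_singleton_iff]
    tauto
  have c3 := ncard_fibrePart hω h he
  have c3' := ncard_fibrePart hω h he'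
  have c2 : ({pointQ ω, pointQ' ω} : Set P2).ncard = 2 := Set.ncard_pair (pointQ_ne_pointQ' hω)
  have f3 : (fibrePart h e).Finite := Set.finite_of_ncard_ne_zero (by omega)
  have f3' : (fibrePart h e').Finite := Set.finite_of_ncard_ne_zero (by omega)
  have d1 : Disjoint ({pointP} : Set P2) {pointQ ω, pointQ' ω} := by
    rw [Set.disjoint_singleton_left, ← hQ]
    rintro ⟨hq, -⟩
    have := (hasInvariants_pointQ h).eq_of_mem_orbit hasInvariants_pointP hq
    grind
  have d2 : Disjoint (fibrePart h e) (fibrePart h e') := Set.disjoint_left.2 fun p hp hp' =>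
    notMem_orbit_of_mem_fibrePart hζ he hee hp hp' (mem_orbit_self hζ p)
  have d3 : ∀ {f f' : ℂ}, 14 * f ^ 2 = 7 * f + 1 → f + f' = 1 / 2 →
      Disjoint (({pointP} : Set P2) ∪ {pointQ ω, pointQ' ω}) (fibrePart h f) := by
    intro f f' hf hff
    rw [Set.disjoint_right]
    intro p hp hp'
    rw [← hP, ← hQ] at hp'
    have hi := hasInvariants_of_mem_fibrePart hf hp
    rcases hp' with ⟨hp', -⟩ | ⟨hp', -⟩
    · have := hasInvariants_pointP.eq_of_mem_orbit hi hp'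
      grind
    · have := (hasInvariants_pointQ h).eq_of_mem_orbit hi hp'
      grind
  have d4 := Set.disjoint_union_right.2 ⟨d3 he hee, d3 he' (by rw [add_comm, hee])⟩
  rw [hset, Set.ncard_union_eq d4 (Set.toFinite _) (f3.union f3'),
    Set.ncard_union_eq d1, Set.ncard_union_eq d2 f3 f3', c3, c3', c2, Set.ncard_singleton]

lemma gradientMap_mem_O28_iff (hζ : IsPrimitiveRoot ζ 7) (p : P2) :
    gradientMap p ∈ O28 hζ ↔ ∃ M ∈ group hζ, ∃ q, gradientMap q = pointP ∧ p = M • q := by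
  constructor
  · intro hp
    obtain ⟨N, hN, h⟩ := mem_orbit_iff.1 hp
    have : p ∈ Set.univ ∩ gradientMap ⁻¹' {N • pointP} := ⟨trivial, h.symm⟩
    rw [inter_preimage_smul (A := Set.univ) hN fun _ _ _ _ => Set.mem_univ _] at this
    obtain ⟨q, ⟨-, hq⟩, rfl⟩ := this
    exact ⟨_, contragredient_mem hN, q, hq, rfl⟩
  · rintro ⟨M, hM, q, hq, rfl⟩
    exact mapsTo_gradientMap_orbit hζ hq (smul_mem_orbit hM (mem_orbit_self hζ q))

/-- The sextic invariant does not vanish on the preimage of the orbit of `[1 : 1 : 1]`, so the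
gradient map is unramified there. -/
lemma eval_Phi6_rep_ne_zero (hζ : IsPrimitiveRoot ζ 7) (h : ω ^ 2 + ω + 1 = 0) {e e' : ℂ}
    (he : 14 * e ^ 2 = 7 * e + 1) (hee : e + e' = 1 / 2) {p : P2}
    (hp : gradientMap p ∈ O28 hζ) : eval p.rep Phi6 ≠ 0 := by
  have he' : 14 * e' ^ 2 = 7 * e' + 1 := by grind
  have key : ∀ {q : P2} {a b : ℂ}, HasInvariants q a b → b ≠ 0 → p ∈ orbit hζ q →
      eval p.rep Phi6 ≠ 0 := by
    rintro q a b ⟨v, hv, rfl, -, rfl⟩ hb hp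
    obtain ⟨M, hM, hp⟩ := mem_orbit_iff.1 hp
    rw [Projectivization.smul_mk, ← p.mk_rep, Projectivization.mk_eq_mk_iff'] at hp
    obtain ⟨c, hc⟩ := hp
    rw [← eval_group_Phi6 hM, ← hc, eval_smul_Phi6] at hb
    exact right_ne_zero_of_mul hb
  obtain ⟨M, hM, q, hq, rfl⟩ := (gradientMap_mem_O28_iff hζ p).1 hp
  have hself := smul_mem_orbit hM (mem_orbit_self hζ q)
  rcases (mem_fibre_iff h he hee q).1 hq with rfl | (rfl | rfl) | hq | hq
  · exact key hasInvariants_pointP (by norm_num) hself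
  · exact key (hasInvariants_pointQ h) (by grind) hself
  · exact key (hasInvariants_pointQ h) (by grind) (smul_mem_orbit hM (pointQ'_mem_orbit hζ h))
  · exact key (hasInvariants_of_mem_fibrePart he hq) (by grind) hself
  · exact key (hasInvariants_of_mem_fibrePart he' hq) (by grind) hself

/-- The arrangement `𝒦` has an ordinary triple point wherever `∇` hits the orbit of `[1 : 1 : 1]`,
as Klein's arrangement of lines has one at the image. -/
lemma isOrdinaryTriplePoint_Phi63 (hζ : IsPrimitiveRoot ζ 7) (hω : IsPrimitiveRoot ω 3) {e e' : ℂ}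
    (he : 14 * e ^ 2 = 7 * e + 1) (hee : e + e' = 1 / 2) {p : P2}
    (hp : gradientMap p ∈ O28 hζ) : IsOrdinaryTriplePoint Phi63 p := by
  have h := cube_root_relation hω
  apply isOrdinaryTriplePoint_of_isTripleVec
  apply isTripleVec_Phi63
  · have h6 := eval_Phi6_rep_ne_zero hζ h he hee hp
    rw [Phi6, map_mul] at h6
    exact right_ne_zero_of_mul h6
  · obtain ⟨M, hM, hMp⟩ := mem_orbit_iff.1 hp
    rw [← p.mk_rep, gradientMap_mk, Projectivization.smul_mk, eq_comm,
      Projectivization.mk_eq_mk_iff'] at hMp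
    obtain ⟨c, hc⟩ := hMp
    rw [← hc]
    refine isTripleVec_smul ?_ ?_
    · exact isTripleVec_mulVec (isTripleVec_Phi21_one hω) M.2 (subst_Phi21 M.2 (subst_Phi4 hM))
    · rintro rfl
      rw [zero_smul] at hc
      exact gradVec_ne_zero p.rep_nonzero hc.symm

end

end Klein

theorem mainTheorem3 (ζ ω : ℂ) (hζ : IsPrimitiveRoot ζ 7) (hω : IsPrimitiveRoot ω 3) :
    (∀ p ∈ Klein.O28 hζ, (Klein.gradientMap ⁻¹' {p}).ncard = 9) ∧
    (Klein.O28 hζ).ncard = 28 ∧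
    (Klein.O56 hζ ω).ncard = 56 ∧
    (∃ p q : Klein.P2,
      Klein.orbit hζ p ≠ Klein.orbit hζ q ∧
      (Klein.orbit hζ p).ncard = 84 ∧
      (Klein.orbit hζ q).ncard = 84 ∧
      Klein.gradientMap ⁻¹' (Klein.O28 hζ) =
        Klein.O28 hζ ∪ Klein.O56 hζ ω ∪ Klein.orbit hζ p ∪ Klein.orbit hζ q) ∧
    (∀ p ∈ Klein.gradientMap ⁻¹' (Klein.O28 hζ),
      Klein.IsOrdinaryTriplePoint Klein.Phi63 p) := by
  have h := Klein.cube_root_relation hω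
  obtain ⟨r, hr⟩ := IsAlgClosed.exists_pow_nat_eq (105 : ℂ) (n := 2) (by norm_num)
  -- The two roots of `14e² = 7e + 1`.
  obtain ⟨e, he, e', hee⟩ : ∃ e : ℂ, 14 * e ^ 2 = 7 * e + 1 ∧ ∃ e', e + e' = 1 / 2 :=
    ⟨(7 + r) / 28, by linear_combination hr / 56, 1 / 2 - (7 + r) / 28, by ring⟩
  have he' : 14 * e' ^ 2 = 7 * e' + 1 := by grind
  have hee' : e' + e = 1 / 2 := by rw [add_comm, hee]
  have c3 := Klein.ncard_fibrePart hω h he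
  have c3' := Klein.ncard_fibrePart hω h he'
  obtain ⟨p, hp⟩ := Set.nonempty_of_ncard_ne_zero (s := Klein.fibrePart h e) (by omega)
  obtain ⟨q, hq⟩ := Set.nonempty_of_ncard_ne_zero (s := Klein.fibrePart h e') (by omega)
  have hp' := Klein.orbit_inter_fibre hζ h he hee hp
  have hq' := Klein.orbit_inter_fibre hζ h he' hee' hq
  refine ⟨fun y hy => ?_, Klein.ncard_O28 hζ, ?_, ⟨p, q, ?_, ?_, ?_, ?_⟩, fun y hy => ?_⟩
  · have := Klein.ncard_inter_preimage (A := Set.univ) (fun _ _ _ _ => Set.mem_univ _) hy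
    rwa [Set.univ_inter, Set.univ_inter, Klein.ncard_fibre hζ hω he hee] at this
  · rw [← Klein.orbit_pointQ, Klein.ncard_orbit (Klein.gradientMap_pointQ h) two_ne_zero]
    rw [Klein.orbit_pointQ_inter_fibre hζ h he hee, Set.ncard_pair (Klein.pointQ_ne_pointQ' hω)]
  · intro hpq
    apply Klein.notMem_orbit_of_mem_fibrePart hζ he hee hp hq
    rw [hpq]
    exact Klein.mem_orbit_self hζ q
  · exact Klein.ncard_orbit (Klein.gradientMap_of_mem_fibrePart he hp) three_ne_zero
      (by rw [hp', c3])
  · exact Klein.ncard_orbit (Klein.gradientMap_of_mem_fibrePart he' hq) three_ne_zero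
      (by rw [hq', c3'])
  · apply Set.Subset.antisymm
    · intro y hy
      obtain ⟨M, hM, x, hx, rfl⟩ := (Klein.gradientMap_mem_O28_iff hζ y).1 hy
      rcases (Klein.mem_fibre_iff h he hee x).1 hx with rfl | (rfl | rfl) | hx | hx
      · exact Or.inl (Or.inl (Or.inl (Klein.smul_mem_orbit hM (Klein.mem_orbit_self hζ _))))
      · exact Or.inl (Or.inl (Or.inr (Klein.smul_mem_orbit hM (Klein.mem_orbit_self hζ _))))
      · exact Or.inl (Or.inl (Or.inr (Klein.smul_mem_orbit hM (Klein.pointQ'_mem_orbit hζ h))))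
      · exact Or.inl (Or.inr
          (Klein.smul_mem_orbit hM (Klein.mem_orbit_of_mem_fibrePart hζ hp hx)))
      · exact Or.inr (Klein.smul_mem_orbit hM (Klein.mem_orbit_of_mem_fibrePart hζ hq hx))
    · rintro y (((hy | hy) | hy) | hy)
      · exact Klein.mapsTo_gradientMap_orbit hζ Klein.gradientMap_pointP hy
      · exact Klein.mapsTo_gradientMap_orbit hζ (Klein.gradientMap_pointQ h) hy
      · exact Klein.mapsTo_gradientMap_orbit hζ (Klein.gradientMap_of_mem_fibrePart he hp) hy
      · exact Klein.mapsTo_gradientMap_orbit hζ (Klein.gradientMap_of_mem_fibrePart he' hq) hy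
  · exact Klein.isOrdinaryTriplePoint_Phi63 hζ hω he hee hy
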